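/- Let $n \ge 4$ and $k \ge 0$ be integers. Let $BC_{n,k}$ be the graph whose nodes are the words $a_k a_{k-1}\cdots a_0$ with all $a_i \in \{0,\dots,n-1\}$, two nodes being adjacent if and only if they differ in exactly one position; for $0 \le i \le k$ let $E_i$ be the set of edges whose ends differ in position $i$. Let $F$ be a set of (faulty) edges of $BC_{n,k}$, put $F_i = F \cap E_i$, and let $r_0 \le r_1 \le \dots \le r_k$ be the numbers $|F_0|, \dots, |F_k|$ (with multiplicity) in nondecreasing order. Suppose that \[ r_0 \le \begin{cases} n-5 & \text{if } n = 7,\\ n-4 & \text{if } n \ne 7, \end{cases} \] and that for every $1 \le i \le k$ \[ r_i \le \begin{cases} \max\{0,\, n^i-5\} & \text{if } 4 \le n \le 9,\\ \left\lceil \frac{n^i-1}{2} \right\rceil (n-2) - \frac{3n}{2} & \text{if } n \ge 10. \end{cases} \] Then the graph $BC_{n,k} - F$, obtained from $BC_{n,k}$ by deleting the edges in $F$, is paired 2-disjoint path coverable: for any four distinct nodes $s_1, s_2, t_1, t_2$ there are a path from $s_1$ to $t_1$ and a path from $s_2$ to $t_2$ in $BC_{n,k} - F$ that have no node in common and together contain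 every node of $BC_{n,k}$. -/

import Mathlib

/-- The node set of `BC_{n,k}`: words `a_k a_{k-1} … a_0` over the alphabet `{0, …, n-1}`. -/
abbrev BCubeNode (n k : ℕ) : Type := Fin (k + 1) → Fin n

/-- The (logical graph of) BCube `BC_{n,k}`: two nodes are adjacent iff they differ in exactly
one position. -/
def BCube (n k : ℕ) : SimpleGraph (BCubeNode n k) where
  Adj u v := ∃! i : Fin (k + 1), u i ≠ v i
  symm := ⟨fun u v h => by simpa only [ne_comm] using h⟩
  loopless := ⟨fun u ⟨_, hi, _⟩ => hi rfl⟩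

/-- The set `E_i` of edges of `BC_{n,k}` in the `i`-th dimension: the edges whose ends differ
in position `i`. -/
def BCube.dimEdges (n k : ℕ) (i : Fin (k + 1)) : Set (Sym2 (BCubeNode n k)) :=
  {e | ∃ u v : BCubeNode n k, (BCube n k).Adj u v ∧ u i ≠ v i ∧ e = s(u, v)}

/-- `|F_i|`, the number of faulty edges in the `i`-th dimension, where `F_i = F ∩ E_i`. -/
noncomputable def BCube.faultCount {n k : ℕ} (F : Set (Sym2 (BCubeNode n k)))
    (i : Fin (k + 1)) : ℕ :=
  (F ∩ BCube.dimEdges n k i).ncard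

/-- The numbers `|F_0|, …, |F_k|` (with multiplicity) arranged in nondecreasing order
`r_0 ≤ r_1 ≤ … ≤ r_k`. -/
noncomputable def BCube.sortedFaultCount {n k : ℕ} (F : Set (Sym2 (BCubeNode n k)))
    (j : Fin (k + 1)) : ℕ :=
  BCube.faultCount F (Tuple.sort (BCube.faultCount F) j)

/-- The largest number of faults allowed in the dimension with the `i`-th smallest number of
faults (`i = 0, 1, …`), as a rational number. -/
def BCube.faultBound (n i : ℕ) : ℚ :=
  if i = 0 then
    if n = 7 then (n : ℚ) - 5 else (n : ℚ) - 4
  else if n ≤ 9 then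
    max 0 ((n : ℚ) ^ i - 5)
  else
    (⌈((n : ℚ) ^ i - 1) / 2⌉ : ℚ) * ((n : ℚ) - 2) - 3 * (n : ℚ) / 2

/-- `F` is a set of edges of `BC_{n,k}` that satisfies the f-PEF conditions. -/
def BCube.IsFPEF {n k : ℕ} (F : Set (Sym2 (BCubeNode n k))) : Prop :=
  F ⊆ (BCube n k).edgeSet ∧
    ∀ i : Fin (k + 1), (BCube.sortedFaultCount F i : ℚ) ≤ BCube.faultBound n i

/-- `G` is paired 2-disjoint path coverable: for any four distinct nodes `s₁, s₂, t₁, t₂` there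
are two vertex-disjoint paths, from `s₁` to `t₁` and from `s₂` to `t₂`, that cover all nodes. -/
def SimpleGraph.IsPairedTwoDPC {V : Type*} (G : SimpleGraph V) : Prop :=
  ∀ s₁ s₂ t₁ t₂ : V, s₁ ≠ s₂ → t₁ ≠ t₂ → s₁ ≠ t₁ → s₁ ≠ t₂ → s₂ ≠ t₁ → s₂ ≠ t₂ →
    ∃ (p : G.Walk s₁ t₁) (q : G.Walk s₂ t₂), p.IsPath ∧ q.IsPath ∧
      (∀ v : V, ¬ (v ∈ p.support ∧ v ∈ q.support)) ∧
      (∀ v : V, v ∈ p.support ∨ v ∈ q.support)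

/-! The proof is by induction on the number of dimensions. Fixing the entry in the dimension that
receives the last bound cuts `BC_{n,k+1}` into `n` layers, copies of `BC_{n,k}` with `N = n^(k+1)`
nodes each. Every layer inherits the bounds of the other dimensions and is coverable by induction
(`isPairedTwoDPC_of_faultCount_le`). Two layers are called adjacent if at most `(N - 4) / 2` of the
`N` edges between them are faulty. A nonadjacent pair uses up at least `⌊N/2⌋ - 1` faults, so the
bound leaves at most `n - 3` nonadjacent pairs, and at most one if `n ≤ 9` (`bad_pairs_bounds`).

Such a dense layer graph allows two things. First, the layers of the terminals, with a few
connecting layers, can be covered by two disjoint paths with the prescribed ends; this is a case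
distinction on how the terminals are distributed over the layers (`HasLayerCover`). Connecting
layers exist by a count: each layer outside a set `K` that is not adjacent to all of `K` costs a
nonadjacent pair of its own (`card_le_card_adj_all`). Secondly, the layer graph has a Hamiltonian
cycle, along which the remaining layers are absorbed (`exists_cover_of_cyclic_successor`). In a
covered layer the paths have at least `N - 2` edges, of which the faults towards the next layer
spoil at most `N - 4`; an unspoiled edge is replaced by a detour along a Hamiltonian path of the
next layer.

The base case is a complete graph with at most `n - 4` edges missing. A nonterminal vertex with few
but some missing edges is deleted, the rest is covered, and the vertex is inserted into an edge of
the paths. The only obstruction is a set of exactly three nonterminal vertices that are pairwise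
nonadjacent, which explains the exception `n = 7`. -/

/-! ### Walks as vertex lists -/

/-- `l` is the vertex list of a walk from `s` to `t` in `G`. -/
def SimpleGraph.IsWalkList {V : Type*} (G : SimpleGraph V) (s t : V) (l : List V) : Prop :=
  l.IsChain G.Adj ∧ l.head? = some s ∧ l.getLast? = some t

namespace SimpleGraph.IsWalkList

variable {V W : Type*} {G : SimpleGraph V} {s t a b : V} {l l' : List V}

theorem singleton (G : SimpleGraph V) (s : V) : G.IsWalkList s s [s] := by
  simp [IsWalkList]

theorem append (h : G.IsWalkList s a l) (hab : G.Adj a b) (h' : G.IsWalkList b t l') :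
    G.IsWalkList s t (l ++ l') := by
  refine ⟨List.isChain_append.2 ⟨h.1, h'.1, ?_⟩, ?_, ?_⟩
  · intro x hx y hy
    rw [h.2.2] at hx
    rw [h'.2.1] at hy
    simp only [Option.mem_def, Option.some.injEq] at hx hy
    exact hx ▸ hy ▸ hab
  · simp [List.head?_append, h.2.1]
  · simp [List.getLast?_append, h'.2.2]

theorem reverse (h : G.IsWalkList s t l) : G.IsWalkList t s l.reverse := by
  refine ⟨List.isChain_reverse.2 (h.1.imp fun _ _ h => h.symm), ?_, ?_⟩
  · simp [h.2.2]
  · simp [h.2.1]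

theorem map {G' : SimpleGraph W} (f : V → W) (hf : ∀ u v, G.Adj u v → G'.Adj (f u) (f v))
    (h : G.IsWalkList s t l) : G'.IsWalkList (f s) (f t) (l.map f) := by
  refine ⟨(List.isChain_map f).2 (h.1.imp fun _ _ => hf _ _), ?_, ?_⟩
  · simp [h.2.1]
  · simp [h.2.2]

/-- A walk can be cut between two consecutive vertices. -/
theorem split {l₁ l₂ : List V} (h : G.IsWalkList s t (l₁ ++ a :: b :: l₂)) :
    G.IsWalkList s a (l₁ ++ [a]) ∧ G.IsWalkList b t (b :: l₂) ∧ G.Adj a b := by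
  obtain ⟨h1, h2, h3⟩ := h
  have h1' := List.isChain_append_cons_cons.1 h1
  refine ⟨⟨h1'.1, ?_, by simp⟩, ⟨h1'.2.2, by simp, ?_⟩, h1'.2.1⟩
  · cases l₁ <;> simpa using h2
  · simpa [List.getLast?_append] using h3

theorem exists_second (h : G.IsWalkList s t l) (hst : s ≠ t) : ∃ a ∈ l, G.Adj s a := by
  obtain ⟨h1, h2, h3⟩ := h
  match l, h1, h2, h3 with
  | [], _, h2, _ => simp at h2
  | [x], _, h2, h3 =>
    simp only [List.head?_cons, Option.some.injEq, List.getLast?_singleton] at h2 h3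
    exact absurd (h2.symm.trans h3) hst
  | x :: y :: l, h1, h2, _ =>
    simp only [List.head?_cons, Option.some.injEq] at h2
    subst h2
    exact ⟨y, by simp, (List.isChain_cons_cons.1 h1).1⟩

theorem start_mem (h : G.IsWalkList s t l) : s ∈ l := List.mem_of_head? h.2.1

theorem end_mem (h : G.IsWalkList s t l) : t ∈ l := List.mem_of_getLast? h.2.2

theorem count_start [DecidableEq V] (h : G.IsWalkList s t l) : 1 ≤ l.count s :=
  List.count_pos_iff.2 h.start_mem

theorem count_end [DecidableEq V] (h : G.IsWalkList s t l) : 1 ≤ l.count t :=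
  List.count_pos_iff.2 h.end_mem

theorem exists_walk (h : G.IsWalkList s t l) : ∃ p : G.Walk s t, p.support = l := by
  obtain ⟨h1, h2, h3⟩ := h
  have hne : l ≠ [] := by rintro rfl; simp at h2
  have hs : l.head hne = s := by
    rw [List.head?_eq_some_head hne] at h2; simpa using h2
  have ht : l.getLast hne = t := by
    rw [List.getLast?_eq_some_getLast hne] at h3; simpa using h3
  subst hs ht
  exact ⟨Walk.ofSupport l hne h1, Walk.support_ofSupport hne h1⟩

end SimpleGraph.IsWalkList

theorem SimpleGraph.Walk.isWalkList_support {V : Type*} {G : SimpleGraph V} {s t : V}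
    (p : G.Walk s t) : G.IsWalkList s t p.support := by
  refine ⟨p.isChain_adj_support, ?_, ?_⟩
  · rw [List.head?_eq_some_head p.support_ne_nil]; simp
  · rw [List.getLast?_eq_some_getLast p.support_ne_nil]; simp

theorem SimpleGraph.IsPairedTwoDPC.exists_lists {V : Type*} [DecidableEq V] {G : SimpleGraph V}
    (h : G.IsPairedTwoDPC) {s₁ t₁ s₂ t₂ : V} (hs : s₁ ≠ s₂) (ht : t₁ ≠ t₂) (h11 : s₁ ≠ t₁)
    (h12 : s₁ ≠ t₂) (h21 : s₂ ≠ t₁) (h22 : s₂ ≠ t₂) :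
    ∃ l₁ l₂ : List V, G.IsWalkList s₁ t₁ l₁ ∧ G.IsWalkList s₂ t₂ l₂ ∧
      ∀ v, l₁.count v + l₂.count v = 1 := by
  obtain ⟨p, q, hp, hq, hd, hc⟩ := h s₁ s₂ t₁ t₂ hs ht h11 h12 h21 h22
  refine ⟨p.support, q.support, p.isWalkList_support, q.isWalkList_support, fun v => ?_⟩
  rw [List.Nodup.count hp.support_nodup, List.Nodup.count hq.support_nodup]
  have := hd v
  have := hc v
  grind

theorem SimpleGraph.isPairedTwoDPC_of_exists_lists {V : Type*} [BEq V] [LawfulBEq V]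
    {G : SimpleGraph V}
    (h : ∀ s₁ t₁ s₂ t₂ : V, s₁ ≠ s₂ → t₁ ≠ t₂ → s₁ ≠ t₁ → s₁ ≠ t₂ → s₂ ≠ t₁ → s₂ ≠ t₂ →
      ∃ l₁ l₂ : List V, G.IsWalkList s₁ t₁ l₁ ∧ G.IsWalkList s₂ t₂ l₂ ∧
        ∀ v, l₁.count v + l₂.count v = 1) : G.IsPairedTwoDPC := by
  intro s₁ s₂ t₁ t₂ hs ht h11 h12 h21 h22
  obtain ⟨l₁, l₂, hl₁, hl₂, hc⟩ := h s₁ t₁ s₂ t₂ hs ht h11 h12 h21 h22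
  obtain ⟨p, rfl⟩ := hl₁.exists_walk
  obtain ⟨q, rfl⟩ := hl₂.exists_walk
  refine ⟨p, q, ?_, ?_, fun v hv => ?_, fun v => ?_⟩
  · rw [Walk.isPath_def, List.nodup_iff_count_le_one]
    intro a; have := hc a; omega
  · rw [Walk.isPath_def, List.nodup_iff_count_le_one]
    intro a; have := hc a; omega
  · have h1 := List.count_pos_iff.2 hv.1
    have h2 := List.count_pos_iff.2 hv.2
    have := hc v
    omega
  · rw [← List.count_pos_iff, ← List.count_pos_iff (l := q.support)]
    have := hc v
    omega

theorem SimpleGraph.IsPairedTwoDPC.mono {V : Type*} {G G' : SimpleGraph V} (hle : G ≤ G')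
    (h : G.IsPairedTwoDPC) : G'.IsPairedTwoDPC := by
  classical
  refine isPairedTwoDPC_of_exists_lists fun s₁ t₁ s₂ t₂ hs ht h11 h12 h21 h22 => ?_
  obtain ⟨l₁, l₂, hl₁, hl₂, hc⟩ := h.exists_lists hs ht h11 h12 h21 h22
  exact ⟨l₁, l₂, by simpa using hl₁.map id fun _ _ h => hle h,
    by simpa using hl₂.map id fun _ _ h => hle h, hc⟩

theorem SimpleGraph.IsPairedTwoDPC.of_comap_equiv {V W : Type*} (e : W ≃ V) {G : SimpleGraph V}
    (h : (G.comap e).IsPairedTwoDPC) : G.IsPairedTwoDPC := by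
  classical
  refine isPairedTwoDPC_of_exists_lists fun s₁ t₁ s₂ t₂ hs ht h11 h12 h21 h22 => ?_
  obtain ⟨l₁, l₂, hl₁, hl₂, hc⟩ := h.exists_lists (s₁ := e.symm s₁) (t₁ := e.symm t₁)
    (s₂ := e.symm s₂) (t₂ := e.symm t₂) (by simpa) (by simpa) (by simpa) (by simpa) (by simpa)
    (by simpa)
  refine ⟨l₁.map e, l₂.map e, by simpa using hl₁.map e fun _ _ h => h,
    by simpa using hl₂.map e fun _ _ h => h, fun v => ?_⟩
  rw [← e.apply_symm_apply v, List.count_map_of_injective _ _ e.injective,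
    List.count_map_of_injective _ _ e.injective]
  exact hc _

/-- In a paired 2-disjoint path coverable graph with at least four vertices, any two vertices
are joined by a Hamiltonian path. -/
theorem SimpleGraph.IsPairedTwoDPC.exists_hamiltonian_list {V : Type*} [Fintype V]
    [DecidableEq V] {G : SimpleGraph V} (h : G.IsPairedTwoDPC) (hV : 4 ≤ Fintype.card V)
    {s t : V} (hst : s ≠ t) : ∃ l : List V, G.IsWalkList s t l ∧ ∀ v, l.count v = 1 := by
  obtain ⟨a, ha, b, hb, hab⟩ : ∃ a ∈ ({s, t}ᶜ : Finset V), ∃ b ∈ ({s, t}ᶜ : Finset V), a ≠ b := by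
    apply Finset.one_lt_card.1
    rw [Finset.card_compl, Finset.card_pair hst]
    omega
  simp only [Finset.mem_compl, Finset.mem_insert, Finset.mem_singleton, not_or] at ha hb
  obtain ⟨l₁, l₂, hl₁, hl₂, hc⟩ := h.exists_lists (s₁ := a) (t₁ := b) (s₂ := s) (t₂ := t)
    ha.1 hb.2 hab ha.2 (Ne.symm hb.1) hst
  -- The neighbour `c` of `a` lies on the path from `a`, hence off the path from `s` to `t`.
  -- Disjoint paths from `s` to `a` and from `t` to `c` are then joined by the edge `ac`.
  obtain ⟨c, hc1, hac⟩ := hl₁.exists_second hab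
  have hcs : c ≠ s := by
    rintro rfl
    have := hc c; have := hl₂.count_start; have := List.count_pos_iff.2 hc1; omega
  have hct : c ≠ t := by
    rintro rfl
    have := hc c; have := hl₂.count_end; have := List.count_pos_iff.2 hc1; omega
  obtain ⟨m₁, m₂, hm₁, hm₂, hm⟩ := h.exists_lists (s₁ := s) (t₁ := a) (s₂ := t) (t₂ := c)
    hst hac.ne (Ne.symm ha.1) hcs.symm (Ne.symm ha.2) hct.symm
  refine ⟨m₁ ++ m₂.reverse, hm₁.append hac hm₂.reverse, fun v => ?_⟩
  rw [List.count_append, List.count_reverse]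
  exact hm v

/-! ### Path edges avoiding a vertex set, and detours -/

/-- `a` and `b` occur consecutively, in this order, in `l₁` or in `l₂`. -/
def List.ConsecIn {V : Type*} (l₁ l₂ : List V) (a b : V) : Prop :=
  [a, b] <:+: l₁ ∨ [a, b] <:+: l₂

/-- No two entries outside `X` are consecutive, so they alternate at best with entries in `X`; each
end that lies in `X` saves one. -/
theorem List.length_add_le_of_consecutive {V : Type*} (X : V → Prop) [DecidablePred X] :
    ∀ (a : V) (l : List V), (∀ u v, [u, v] <:+: a :: l → X u ∨ X v) →
      (a :: l).length + (if X a then 1 else 0) +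
        (if X ((a :: l).getLast (by simp)) then 1 else 0) ≤ 2 * (a :: l).countP X + 1
  | a, [], _ => by by_cases h : X a <;> simp [h]
  | a, b :: l, h => by
    have ih := List.length_add_le_of_consecutive X b l fun u v huv =>
      h u v (huv.trans (List.suffix_cons a _).isInfix)
    have h1 := h a b ⟨[], l, by simp⟩
    rw [List.countP_cons, List.getLast_cons (by simp)]
    simp only [List.length_cons, decide_eq_true_eq] at ih ⊢
    by_cases ha : X a
    · simp only [ha, if_true]
      omega
    · have hb : X b := by tauto
      simp only [ha, hb, if_true, if_false] at ih ⊢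
      omega

theorem SimpleGraph.IsWalkList.length_add_le {V : Type*} {G : SimpleGraph V} {s t : V}
    {l : List V} (hl : G.IsWalkList s t l) (X : V → Prop) [DecidablePred X]
    (h : ∀ u v, [u, v] <:+: l → X u ∨ X v) :
    l.length + (if X s then 1 else 0) + (if X t then 1 else 0) ≤ 2 * l.countP X + 1 := by
  obtain ⟨-, h2, h3⟩ := hl
  match l, h2, h3, h with
  | [], h2, _, _ => simp at h2
  | a :: l, h2, h3, h =>
    have := List.length_add_le_of_consecutive X a l h
    rw [List.getLast?_eq_some_getLast (by simp)] at h3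
    simp only [List.head?_cons, Option.some.injEq] at h2 h3
    rw [h3] at this
    subst h2
    exact this

theorem List.countP_eq_sum_count {V : Type*} [DecidableEq V] [Fintype V] (X : V → Prop)
    [DecidablePred X] (l : List V) :
    l.countP X = ∑ v ∈ Finset.univ.filter X, l.count v := by
  induction l with
  | nil => simp
  | cons a l ih =>
    rw [List.countP_cons, ih]
    simp only [List.count_cons, Finset.sum_add_distrib]
    by_cases h : X a <;> simp [h, Finset.sum_ite_eq]

theorem List.length_eq_sum_count {V : Type*} [DecidableEq V] [Fintype V] (l : List V) :
    l.length = ∑ v, l.count v := by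
  have := List.countP_eq_sum_count (fun _ : V => True) l
  simpa using this

/-- Two walks that together visit every vertex of `S` once, have consecutive vertices outside of
`X` if `X` is small enough; vertices in `X` at the ends of the walks count only half. -/
theorem SimpleGraph.exists_consecIn_avoiding {V : Type*} [DecidableEq V] [Fintype V]
    {G : SimpleGraph V} {s₁ t₁ s₂ t₂ : V} {l₁ l₂ : List V} (hl₁ : G.IsWalkList s₁ t₁ l₁)
    (hl₂ : G.IsWalkList s₂ t₂ l₂) (S : Finset V)
    (hS : ∀ v, l₁.count v + l₂.count v = if v ∈ S then 1 else 0)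
    (X : V → Prop) [DecidablePred X]
    (hX : 2 * (S.filter X).card + 2 < S.card + (if X s₁ then 1 else 0) + (if X t₁ then 1 else 0) +
      (if X s₂ then 1 else 0) + (if X t₂ then 1 else 0)) :
    ∃ u v, ¬ X u ∧ ¬ X v ∧ List.ConsecIn l₁ l₂ u v := by
  -- If every edge met `X`, the length bounds for the two walks would add up to the negation of
  -- `hX`.
  by_contra! hcon
  have h1 := hl₁.length_add_le X fun u v huv => by
    by_contra! h
    exact hcon u v h.1 h.2 (Or.inl huv)
  have h2 := hl₂.length_add_le X fun u v huv => by
    by_contra! h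
    exact hcon u v h.1 h.2 (Or.inr huv)
  have e1 : l₁.length + l₂.length = S.card := by
    rw [List.length_eq_sum_count, List.length_eq_sum_count, ← Finset.sum_add_distrib]
    simp [hS]
  have e2 : l₁.countP X + l₂.countP X = (S.filter X).card := by
    rw [List.countP_eq_sum_count, List.countP_eq_sum_count, ← Finset.sum_add_distrib]
    simp only [hS, Finset.sum_ite_mem, Finset.sum_const, smul_eq_mul, mul_one]
    congr 1
    ext; simp [and_comm]
  omega

/-- Replace an edge of one of two walks by a detour. -/
theorem SimpleGraph.exists_detour {V : Type*} [BEq V] [LawfulBEq V] {G : SimpleGraph V}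
    {s₁ t₁ s₂ t₂ : V} {l₁ l₂ : List V} (hl₁ : G.IsWalkList s₁ t₁ l₁)
    (hl₂ : G.IsWalkList s₂ t₂ l₂) {u v u' v' : V} (h : List.ConsecIn l₁ l₂ u v) {m : List V}
    (hm : G.IsWalkList u' v' m) (hu : G.Adj u u') (hv : G.Adj v' v) :
    ∃ l₁' l₂' : List V, G.IsWalkList s₁ t₁ l₁' ∧ G.IsWalkList s₂ t₂ l₂' ∧
      (∀ w, l₁'.count w + l₂'.count w = l₁.count w + l₂.count w + m.count w) ∧
      (∀ a b, [a, b] <:+: m → List.ConsecIn l₁' l₂' a b) ∧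
      ∀ a b, a ≠ u → List.ConsecIn l₁ l₂ a b → List.ConsecIn l₁' l₂' a b := by
  have key : ∀ {s t : V} {l : List V}, G.IsWalkList s t l → [u, v] <:+: l →
      ∃ l', G.IsWalkList s t l' ∧ (∀ w, l'.count w = l.count w + m.count w) ∧
        m <:+: l' ∧ ∀ a b, a ≠ u → [a, b] <:+: l → [a, b] <:+: l' := by
    rintro s t l hl ⟨A, B, rfl⟩
    have e : A ++ [u, v] ++ B = A ++ u :: v :: B := by simp
    rw [e] at hl ⊢
    obtain ⟨h1, h2, -⟩ := hl.split
    refine ⟨(A ++ [u]) ++ (m ++ v :: B), h1.append hu (hm.append hv h2), fun w => ?_,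
      ⟨A ++ [u], v :: B, by simp⟩, fun a b hau hab => ?_⟩
    · simp only [List.count_append, List.count_cons, List.count_nil]
      omega
    · have : [a, b] <:+: (A ++ [u]) ++ (v :: B) := by simpa using hab
      rw [List.infix_append_iff_ne_nil] at this
      rcases this with h | h | ⟨l₁, l₂, h1, h2, h3, h4, h5⟩
      · exact h.trans ⟨[], m ++ v :: B, by simp⟩
      · exact h.trans ⟨A ++ [u] ++ m, [], by simp⟩
      -- A pair straddling the cut would start with the last entry of `A ++ [u]`, which is `u`.
      · exfalso
        match l₁, l₂, h1, h2, h3 with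
        | [x], [y], h1, h2, h3 =>
          simp only [List.cons_append, List.nil_append, List.cons.injEq] at h3
          obtain ⟨A', hA'⟩ := h4
          have := congrArg List.getLast? hA'
          simp at this
          exact hau (h3.1.trans this)
        | [x], y :: z :: l, h1, h2, h3 => simp at h3
        | x :: y :: [], z :: l, h1, h2, h3 => simp at h3
        | x :: y :: w :: l', z :: l, h1, h2, h3 => simp at h3
  rcases h with h | h
  · obtain ⟨l', h1, h2, h3, h4⟩ := key hl₁ h
    refine ⟨l', l₂, h1, hl₂, fun w => ?_, fun a b hab => Or.inl (hab.trans h3), ?_⟩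
    · rw [h2]; omega
    · rintro a b ha (h | h)
      exacts [Or.inl (h4 a b ha h), Or.inr h]
  · obtain ⟨l', h1, h2, h3, h4⟩ := key hl₂ h
    refine ⟨l₁, l', hl₁, h1, fun w => ?_, fun a b hab => Or.inr (hab.trans h3), ?_⟩
    · rw [h2]; omega
    · rintro a b ha (h | h)
      exacts [Or.inl h, Or.inr (h4 a b ha h)]

/-! ### Complete graphs with few edges removed -/

section Complete

theorem SimpleGraph.IsWalkList.of_nodup_of_adj {V : Type*} {G : SimpleGraph V} {s t : V} (l : List V)
    (hG : ∀ u ∈ s :: l, ∀ v ∈ l ++ [t], u ≠ v → G.Adj u v) (hnd : (s :: (l ++ [t])).Nodup) :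
    G.IsWalkList s t (s :: (l ++ [t])) := by
  induction l generalizing s with
  | nil =>
    have : s ≠ t := by simpa using hnd
    simpa using (singleton G s).append (hG s (by simp) t (by simp) this) (singleton G t)
  | cons a l ih =>
    have hsa : s ≠ a := by
      rintro rfl
      simp at hnd
    refine (singleton G s).append (hG s (by simp) a (by simp) hsa) (ih ?_ ?_)
    · intro u hu v hv
      exact hG u (List.mem_cons_of_mem _ hu) v (List.mem_cons_of_mem _ hv)
    · exact (List.nodup_cons.1 hnd).2

variable {V : Type*} [DecidableEq V]

/-- A vertex set that carries few edges, and few weights `a`, contains a vertex that is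
nonisolated but meets few of them. -/
theorem SimpleGraph.exists_light_vertex (K : SimpleGraph V) [DecidableRel K.Adj] (M : Finset V)
    (a : V → ℕ) (hsum : ∑ v ∈ M, (2 * a v + (M.filter (K.Adj v)).card) ≤ 2 * M.card)
    (hne : ∃ v ∈ M, 1 ≤ a v + (M.filter (K.Adj v)).card)
    (htri : ¬ (M.card = 3 ∧ ∀ u ∈ M, ∀ v ∈ M, u ≠ v → K.Adj u v)) :
    ∃ v ∈ M, 1 ≤ a v + (M.filter (K.Adj v)).card ∧
      a v + 2 * (M.filter (K.Adj v)).card ≤ M.card := by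
  by_contra! hcon
  set b : V → ℕ := fun v => (M.filter (K.Adj v)).card with hb
  set P := M.filter fun v => 1 ≤ a v + b v with hP
  have hPM : P ⊆ M := Finset.filter_subset _ _
  have hq : 1 ≤ P.card := by
    obtain ⟨v, hv, h⟩ := hne
    exact Finset.card_pos.2 ⟨v, Finset.mem_filter.2 ⟨hv, h⟩⟩
  have hqp : P.card ≤ M.card := Finset.card_le_card hPM
  have hsub : ∀ v ∈ P, M.filter (K.Adj v) ⊆ P.erase v := by
    intro v hv u hu
    rw [Finset.mem_filter] at hu
    refine Finset.mem_erase.2 ⟨hu.2.ne', Finset.mem_filter.2 ⟨hu.1, ?_⟩⟩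
    have : 0 < b u := Finset.card_pos.2 ⟨v, Finset.mem_filter.2 ⟨hPM hv, hu.2.symm⟩⟩
    omega
  have hbq : ∀ v ∈ P, b v ≤ P.card - 1 := fun v hv => by
    rw [← Finset.card_erase_of_mem hv]
    exact Finset.card_le_card (hsub v hv)
  have h1 : 2 * ∑ v ∈ P, a v + ∑ v ∈ P, b v ≤ 2 * M.card := by
    rw [Finset.mul_sum, ← Finset.sum_add_distrib]
    exact (Finset.sum_le_sum_of_subset hPM).trans hsum
  have h2 : P.card * (M.card + 1) ≤ ∑ v ∈ P, a v + 2 * ∑ v ∈ P, b v := by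
    rw [Finset.mul_sum, ← Finset.sum_add_distrib, ← smul_eq_mul]
    exact Finset.card_nsmul_le_sum _ _ _ fun v hv =>
      hcon v (hPM hv) (Finset.mem_filter.1 hv).2
  have h3 : ∑ v ∈ P, b v ≤ P.card * (P.card - 1) := by
    rw [← smul_eq_mul]
    exact Finset.sum_le_card_nsmul _ _ _ hbq
  -- If all nonisolated vertices are heavy, then `|P| (|M| + 1) ≤ ∑ a + 2 ∑ b ≤ 2 (2 ∑ a + ∑ b) ≤ 4
  -- |M|`, so `|P| ≤ 3`. With `∑ b ≤ |P| (|P| - 1)` only `|P| = |M| = 3` and `∑ b = 6` survive,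
  -- which is the excluded triangle.
  rcases le_or_gt 4 P.card with h4 | h4
  · have := Nat.mul_le_mul_right (M.card + 1) h4
    omega
  · have : P.card = 1 ∨ P.card = 2 ∨ P.card = 3 := by omega
    rcases this with h | h | h <;> rw [h] at h2 h3 hqp hbq
    · omega
    · omega
    · have hM : M.card = 3 := by omega
      have hPeq : P = M := Finset.eq_of_subset_of_card_le hPM (by omega)
      refine htri ⟨hM, fun u hu v hv huv => ?_⟩
      have hb2 : b u = 2 := by
        by_contra hne
        have hlt : ∑ v ∈ P, b v < ∑ v ∈ P, 2 :=
          Finset.sum_lt_sum hbq ⟨u, hPeq ▸ hu, by have := hbq u (hPeq ▸ hu); omega⟩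
        rw [Finset.sum_const, h] at hlt
        simp only [smul_eq_mul] at hlt
        omega
      have : M.filter (K.Adj u) = P.erase u := by
        apply Finset.eq_of_subset_of_card_le (hsub u (hPeq ▸ hu))
        rw [Finset.card_erase_of_mem (hPeq ▸ hu), h]
        exact hb2.ge
      have hv' : v ∈ P.erase u := Finset.mem_erase.2 ⟨huv.symm, hPeq ▸ hv⟩
      rw [← this] at hv'
      exact (Finset.mem_filter.1 hv').2

/-- The vertex removed in the induction must not leave the excluded triangle behind. If `M \ {y}` is
a triangle of `K`, it takes 6 of the total weight 8. What remains is too little to burden all three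
corners, so some corner `x` has `a x = 0` and is not joined to `y`; without `x`, too few edges at
`y` remain for another triangle. -/
theorem SimpleGraph.exists_light_vertex_no_triangle (K : SimpleGraph V) [DecidableRel K.Adj]
    (M : Finset V) (a : V → ℕ)
    (hsum : ∑ v ∈ M, (2 * a v + (M.filter (K.Adj v)).card) ≤ 2 * M.card)
    (hne : ∃ v ∈ M, 1 ≤ a v + (M.filter (K.Adj v)).card)
    (htri : ¬ (M.card = 3 ∧ ∀ u ∈ M, ∀ v ∈ M, u ≠ v → K.Adj u v)) :
    ∃ x ∈ M, 1 ≤ a x + (M.filter (K.Adj x)).card ∧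
      a x + 2 * (M.filter (K.Adj x)).card ≤ M.card ∧
      ¬ ((M.erase x).card = 3 ∧ ∀ u ∈ M.erase x, ∀ v ∈ M.erase x, u ≠ v → K.Adj u v) := by
  by_cases hT : ∃ y ∈ M, (M.erase y).card = 3 ∧
      ∀ u ∈ M.erase y, ∀ v ∈ M.erase y, u ≠ v → K.Adj u v
  · obtain ⟨y, hy, h3, hadj⟩ := hT
    have hM : M.card = 4 := by rw [Finset.card_erase_of_mem hy] at h3; omega
    have hbx : ∀ x ∈ M.erase y,
        (M.filter (K.Adj x)).card = 2 + if K.Adj y x then 1 else 0 := by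
      intro x hx
      have hxy := Finset.mem_erase.1 hx
      have e : M.filter (K.Adj x) = (M.erase y).erase x ∪ (if K.Adj y x then {y} else ∅) := by
        ext z
        simp only [Finset.mem_filter, Finset.mem_union, Finset.mem_erase]
        constructor
        · rintro ⟨hz, hxz⟩
          by_cases hzy : z = y
          · subst hzy; right; simp [hxz.symm]
          · exact Or.inl ⟨hxz.ne', hzy, hz⟩
        · rintro (⟨h1, h2, h4⟩ | h)
          · exact ⟨h4, hadj x hx z (Finset.mem_erase.2 ⟨h2, h4⟩) (Ne.symm h1)⟩
          · split_ifs at h with h'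
            · rw [Finset.mem_singleton] at h; subst h; exact ⟨hy, h'.symm⟩
            · simp at h
      rw [e, Finset.card_union_of_disjoint, Finset.card_erase_of_mem hx, h3]
      · split_ifs <;> simp
      · split_ifs <;> simp
    have hby : (M.filter (K.Adj y)).card = ∑ x ∈ M.erase y, if K.Adj y x then 1 else 0 := by
      rw [Finset.card_filter, ← Finset.add_sum_erase _ _ hy]
      simp
    have hs : ∑ x ∈ M.erase y, (a x + if K.Adj y x then 1 else 0) ≤ 1 := by
      rw [← Finset.add_sum_erase _ _ hy, hby] at hsum
      have : ∑ x ∈ M.erase y, (2 * a x + (M.filter (K.Adj x)).card) =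
          ∑ x ∈ M.erase y, (a x + if K.Adj y x then 1 else 0) + ∑ x ∈ M.erase y, a x + 6 := by
        rw [Finset.sum_congr rfl fun x hx => by rw [hbx x hx], Finset.sum_add_distrib,
          Finset.sum_add_distrib, Finset.sum_add_distrib, Finset.sum_const, h3, ← Finset.mul_sum]
        simp only [smul_eq_mul]
        ring
      rw [this, hM] at hsum
      simp only [Finset.sum_add_distrib] at hsum ⊢
      omega
    obtain ⟨x, hx, hx0⟩ : ∃ x ∈ M.erase y, a x + (if K.Adj y x then 1 else 0) = 0 := by
      by_contra! h
      have := Finset.card_nsmul_le_sum (M.erase y) _ 1 fun x hx => Nat.one_le_iff_ne_zero.2 (h x hx)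
      rw [h3] at this
      simp only [smul_eq_mul] at this
      omega
    have hb := hbx x hx
    have hxy := Finset.mem_erase.1 hx
    refine ⟨x, hxy.2, by omega, by omega, ?_⟩
    rintro ⟨-, hadj'⟩
    have hlt : 1 < ((M.erase y).erase x).card := by rw [Finset.card_erase_of_mem hx, h3]; simp
    have hK : ∀ z ∈ (M.erase y).erase x, 1 ≤ a z + if K.Adj y z then 1 else 0 := by
      intro z hz
      simp only [Finset.mem_erase] at hz
      rw [if_pos (hadj' y (Finset.mem_erase.2 ⟨Ne.symm hxy.1, hy⟩) z
        (Finset.mem_erase.2 ⟨hz.1, hz.2.2⟩) (Ne.symm hz.2.1))]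
      omega
    have := (Finset.card_nsmul_le_sum _ _ 1 hK).trans
      (Finset.sum_le_sum_of_subset (Finset.erase_subset x (M.erase y)))
    simp only [smul_eq_mul] at this
    omega
  · obtain ⟨v, hv, h1, h2⟩ := K.exists_light_vertex M a hsum hne htri
    exact ⟨v, hv, h1, h2, fun h => hT ⟨v, hv, h⟩⟩

variable [Fintype V]

/-- Four terminals `s₁, t₁, s₂, t₂` and a set `M` of further vertices are covered by two disjoint
paths if not too many adjacencies are missing. -/
theorem SimpleGraph.exists_cover_of_few_nonadjacent (G : SimpleGraph V) [DecidableRel G.Adj]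
    {s₁ t₁ s₂ t₂ : V} (hs : s₁ ≠ s₂) (ht : t₁ ≠ t₂) (h11 : s₁ ≠ t₁) (h12 : s₁ ≠ t₂)
    (h21 : s₂ ≠ t₁) (h22 : s₂ ≠ t₂) (p : ℕ) :
    ∀ M : Finset V, M.card = p → Disjoint M {s₁, t₁, s₂, t₂} →
      2 * ((if G.Adj s₁ t₁ then 0 else 1) + (if G.Adj s₂ t₂ then 0 else 1)) +
        ∑ v ∈ M, (2 * ((({s₁, t₁, s₂, t₂} : Finset V).filter (Gᶜ.Adj v)).card) +
          (M.filter (Gᶜ.Adj v)).card) ≤ 2 * M.card →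
      ¬ (M.card = 3 ∧ ∀ u ∈ M, ∀ v ∈ M, u ≠ v → Gᶜ.Adj u v) →
      ∃ l₁ l₂ : List V, G.IsWalkList s₁ t₁ l₁ ∧ G.IsWalkList s₂ t₂ l₂ ∧
        ∀ v, l₁.count v + l₂.count v = if v ∈ M ∪ {s₁, t₁, s₂, t₂} then 1 else 0 := by
  induction p with
  | zero =>
    intro M hM _ hsum _
    rw [Finset.card_eq_zero] at hM
    subst hM
    have h1 : G.Adj s₁ t₁ := by by_contra h; simp [h] at hsum
    have h2 : G.Adj s₂ t₂ := by by_contra h; simp [h] at hsum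
    refine ⟨[s₁, t₁], [s₂, t₂], (IsWalkList.singleton G s₁).append h1 (IsWalkList.singleton G t₁),
      (IsWalkList.singleton G s₂).append h2 (IsWalkList.singleton G t₂), fun v => ?_⟩
    simp only [List.count_cons, List.count_nil, Finset.empty_union, Finset.mem_insert,
      Finset.mem_singleton, beq_iff_eq]
    grind
  | succ p ih =>
    intro M hM hdisj hsum htri
    set R : Finset V := {s₁, t₁, s₂, t₂} with hR
    set a : V → ℕ := fun v => (R.filter (Gᶜ.Adj v)).card with ha
    have hR4 : R.card = 4 := by
      rw [hR]
      repeat rw [Finset.card_insert_of_notMem]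
      · simp
      all_goals simp [*]
      exact h21.symm
    by_cases hne : ∃ v ∈ M, 1 ≤ a v + (M.filter (Gᶜ.Adj v)).card
    -- Removing `x` lowers the left side of `hsum` by `2 (a x + b x) ≥ 2`, where `b x` counts the
    -- missing edges from `x` to `M`; this pays for the loss of 2 on the right.
    · obtain ⟨x, hx, hx1, hx2, hx3⟩ := Gᶜ.exists_light_vertex_no_triangle M a
        (by simp only [ha]; omega) hne htri
      have hxR : x ∉ R := Finset.disjoint_left.1 hdisj hx
      have hb : ∀ v ∈ M.erase x, (M.filter (Gᶜ.Adj v)).card =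
          ((M.erase x).filter (Gᶜ.Adj v)).card + if Gᶜ.Adj x v then 1 else 0 := by
        intro v hv
        rw [Finset.card_filter, ← Finset.add_sum_erase _ _ hx, Finset.card_filter, add_comm]
        simp only [Gᶜ.adj_comm v x]
      have hbx : (M.filter (Gᶜ.Adj x)).card = ∑ v ∈ M.erase x, if Gᶜ.Adj x v then 1 else 0 := by
        rw [Finset.card_filter, ← Finset.add_sum_erase _ _ hx]
        simp
      have hcard : (M.erase x).card = p := by rw [Finset.card_erase_of_mem hx]; omega
      obtain ⟨l₁, l₂, hl₁, hl₂, hc⟩ := ih (M.erase x) hcard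
        (hdisj.mono_left (Finset.erase_subset _ _)) (by
          rw [← Finset.add_sum_erase _ _ hx, Finset.sum_congr rfl fun v hv => by rw [hb v hv]]
            at hsum
          simp only [← add_assoc] at hsum
          rw [Finset.sum_add_distrib, ← hbx] at hsum
          simp only [ha] at hx1
          omega) hx3
      have hXS : ((M.erase x ∪ R).filter (Gᶜ.Adj x)).card = (M.filter (Gᶜ.Adj x)).card + a x := by
        rw [Finset.filter_union, Finset.card_union_of_disjoint]
        · congr 2
          ext v
          simp only [Finset.mem_filter, Finset.mem_erase]
          exact ⟨fun h => ⟨h.1.2, h.2⟩, fun h => ⟨⟨h.2.ne', h.1⟩, h.2⟩⟩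
        · exact (hdisj.mono_left (Finset.erase_subset _ _)).mono (Finset.filter_subset _ _)
            (Finset.filter_subset _ _)
      have hax : a x = (if Gᶜ.Adj x s₁ then 1 else 0) + (if Gᶜ.Adj x t₁ then 1 else 0) +
          (if Gᶜ.Adj x s₂ then 1 else 0) + (if Gᶜ.Adj x t₂ then 1 else 0) := by
        simp only [ha, hR, Finset.card_filter]
        rw [Finset.sum_insert, Finset.sum_insert, Finset.sum_insert, Finset.sum_singleton]
        · ring
        all_goals simp [*]
        exact h21.symm
      have hcardS : (M.erase x ∪ R).card = p + 4 := by
        rw [Finset.card_union_of_disjoint (hdisj.mono_left (Finset.erase_subset _ _)), hcard, hR4]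
      -- The two paths have `|M| + 1` edges. A terminal lies on one of them and an inner vertex on
      -- two, so at most `a x + 2 b x ≤ |M|` edges meet a non-neighbour of `x`.
      obtain ⟨u, v, hu, hv, huv⟩ := exists_consecIn_avoiding hl₁ hl₂ (M.erase x ∪ R) hc
        (fun v => Gᶜ.Adj x v) (by rw [hXS, hcardS]; omega)
      have hmem : ∀ w, w ∈ l₁ ∨ w ∈ l₂ → w ≠ x := by
        rintro w hw rfl
        have := hc w
        rw [if_neg (by simp [hxR])] at this
        rcases hw with hw | hw <;> have := List.count_pos_iff.2 hw <;> omega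
      have hux : u ≠ x := hmem u (huv.imp (fun h => h.subset (by simp)) fun h => h.subset (by simp))
      have hvx : v ≠ x := hmem v (huv.imp (fun h => h.subset (by simp)) fun h => h.subset (by simp))
      rw [SimpleGraph.compl_adj] at hu hv
      obtain ⟨l₁', l₂', h1, h2, h3, -⟩ := exists_detour hl₁ hl₂ huv (IsWalkList.singleton G x)
        (by_contra fun h => hu ⟨hux.symm, fun h' => h h'.symm⟩)
        (by_contra fun h => hv ⟨hvx.symm, h⟩)
      refine ⟨l₁', l₂', h1, h2, fun w => ?_⟩
      rw [h3, hc, List.count_cons, List.count_nil]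
      by_cases hwx : w = x
      · subst hwx; simp [hxR, hx]
      · simp [hwx, Ne.symm hwx]
    · push Not at hne
      have hadj : ∀ v ∈ M, ∀ u ∈ M ∪ R, v ≠ u → G.Adj v u := by
        intro v hv u hu hvu
        by_contra h
        have hc : Gᶜ.Adj v u := ⟨hvu, h⟩
        have h0 := hne v hv
        rcases Finset.mem_union.1 hu with hu | hu
        · have : 0 < (M.filter (Gᶜ.Adj v)).card :=
            Finset.card_pos.2 ⟨u, Finset.mem_filter.2 ⟨hu, hc⟩⟩
          omega
        · have : 0 < a v := Finset.card_pos.2 ⟨u, Finset.mem_filter.2 ⟨hu, hc⟩⟩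
          omega
      have hT : 2 * ((if G.Adj s₁ t₁ then 0 else 1) + (if G.Adj s₂ t₂ then 0 else 1)) ≤
          2 * M.card := le_trans (Nat.le_add_right _ _) hsum
      -- The vertices of `M` are now adjacent to all others, so they may be distributed freely; only
      -- a path whose ends are not adjacent needs an inner vertex, and `hT` provides enough of them.
      have hsub : ∃ A ⊆ M, (A = ∅ → G.Adj s₁ t₁) ∧ (M \ A = ∅ → G.Adj s₂ t₂) := by
        obtain ⟨x, hx⟩ : M.Nonempty := Finset.card_pos.1 (by omega)
        by_cases h1 : G.Adj s₁ t₁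
        · exact ⟨∅, by simp, fun _ => h1, fun h => by simp at h; simp [h] at hx⟩
        · by_cases h2 : G.Adj s₂ t₂
          · exact ⟨M, subset_rfl, fun h => by simp [h] at hx, fun _ => h2⟩
          · refine ⟨{x}, by simpa, by simp, fun h => ?_⟩
            have := Finset.card_le_card (Finset.sdiff_eq_empty_iff_subset.1 h)
            simp [h1, h2] at hT this
            omega
      obtain ⟨A, hAM, hA1, hA2⟩ := hsub
      have walk : ∀ (A : Finset V) (s t : V), A ⊆ M → s ∈ R → t ∈ R → s ≠ t →
          (A = ∅ → G.Adj s t) → G.IsWalkList s t (s :: (A.toList ++ [t])) := by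
        intro A s t hA hs ht hst h0
        have hsA : s ∉ A := fun h => Finset.disjoint_left.1 hdisj (hA h) hs
        have htA : t ∉ A := fun h => Finset.disjoint_left.1 hdisj (hA h) ht
        by_cases hA0 : A = ∅
        · subst hA0
          simpa using (IsWalkList.singleton G s).append (h0 rfl) (IsWalkList.singleton G t)
        · obtain ⟨x, l, hxl⟩ := List.exists_cons_of_ne_nil
            (show A.toList ≠ [] by simpa using hA0)
          have hnd : (x :: (l ++ [t])).Nodup := by
            have : (A.toList ++ [t]).Nodup := by
              simp [List.nodup_append, A.nodup_toList, htA]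
            rwa [hxl] at this
          have hmem : ∀ v ∈ x :: l, v ∈ A := fun v hv => by
            rw [← hxl] at hv; simpa using hv
          rw [hxl]
          refine (IsWalkList.singleton G s).append ?_ (IsWalkList.of_nodup_of_adj l ?_ hnd)
          · exact (hadj x (hA (hmem x (by simp))) s (Finset.mem_union_right _ hs)
              (by rintro rfl; exact hsA (hmem x (by simp)))).symm
          · intro u hu v hv huv
            refine hadj u (hA (hmem u hu)) v ?_ huv
            rcases List.mem_append.1 hv with hv | hv
            · exact Finset.mem_union_left _ (hA (hmem v (List.mem_cons_of_mem _ hv)))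
            · rw [List.mem_singleton] at hv
              exact Finset.mem_union_right _ (hv ▸ ht)
      refine ⟨_, _, walk A s₁ t₁ hAM (by simp [hR]) (by simp [hR]) h11 hA1,
        walk (M \ A) s₂ t₂ Finset.sdiff_subset (by simp [hR]) (by simp [hR]) h22 hA2, fun v => ?_⟩
      have hcount : ∀ A : Finset V, A.toList.count v = if v ∈ A then 1 else 0 := fun A => by
        rw [List.Nodup.count A.nodup_toList]; simp
      have hvM : v ∈ R → v ∉ M := fun h h' => Finset.disjoint_left.1 hdisj h' h
      have hvA : v ∈ A → v ∈ M := fun h => hAM h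
      simp only [List.count_cons, List.count_append, List.count_nil, hcount, Finset.mem_sdiff,
        Finset.mem_union, beq_iff_eq]
      simp only [hR, Finset.mem_insert, Finset.mem_singleton] at hvM ⊢
      grind

/-- A complete graph on `n` vertices with at most `n - 4` edges removed is paired 2-disjoint path
coverable unless `n = 7` and three edges are removed. -/
theorem SimpleGraph.isPairedTwoDPC_of_card_compl_le (G : SimpleGraph V)
    (h : Gᶜ.edgeSet.ncard + 4 ≤ Fintype.card V)
    (h7 : Fintype.card V = 7 → Gᶜ.edgeSet.ncard ≤ 2) : G.IsPairedTwoDPC := by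
  classical
  refine isPairedTwoDPC_of_exists_lists fun s₁ t₁ s₂ t₂ hs ht h11 h12 h21 h22 => ?_
  have hf : Gᶜ.edgeSet.ncard = Gᶜ.edgeFinset.card := by
    rw [← SimpleGraph.coe_edgeFinset, Set.ncard_coe_finset]
  rw [hf] at h h7
  set R : Finset V := {s₁, t₁, s₂, t₂} with hR
  have hR4 : R.card = 4 := by
    rw [hR]
    repeat rw [Finset.card_insert_of_notMem]
    · simp
    all_goals simp [*]
    exact h21.symm
  have hMcard : Rᶜ.card = Fintype.card V - 4 := by rw [Finset.card_compl, hR4]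
  have hdeg : ∀ v, Gᶜ.degree v = (R.filter (Gᶜ.Adj v)).card + (Rᶜ.filter (Gᶜ.Adj v)).card := by
    intro v
    rw [← SimpleGraph.card_neighborFinset_eq_degree, ← Finset.card_union_of_disjoint,
      ← Finset.filter_union, Finset.union_compl]
    · congr 1; ext; simp
    · exact (disjoint_compl_right (a := R)).mono (Finset.filter_subset _ _)
        (Finset.filter_subset _ _)
  have hsum := Gᶜ.sum_degrees_eq_twice_card_edges
  rw [← Finset.sum_add_sum_compl R] at hsum
  have hcomm : ∑ v ∈ R, (Rᶜ.filter (Gᶜ.Adj v)).card = ∑ v ∈ Rᶜ, (R.filter (Gᶜ.Adj v)).card := by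
    simp only [Finset.card_filter]
    rw [Finset.sum_comm]
    simp only [Gᶜ.adj_comm]
  have hRR : 2 * ((if G.Adj s₁ t₁ then 0 else 1) + (if G.Adj s₂ t₂ then 0 else 1)) ≤
      ∑ v ∈ R, (R.filter (Gᶜ.Adj v)).card := by
    have hind : ∀ x ∈ R, ∀ y ∈ R, x ≠ y →
        (if G.Adj x y then 0 else 1) ≤ (R.filter (Gᶜ.Adj x)).card := by
      intro x hx y hy hxy
      split_ifs with hadj
      · simp
      · exact Finset.card_pos.2 ⟨y, Finset.mem_filter.2 ⟨hy, hxy, hadj⟩⟩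
    have i1 := hind s₁ (by simp [hR]) t₁ (by simp [hR]) h11
    have i2 := hind t₁ (by simp [hR]) s₁ (by simp [hR]) h11.symm
    have i3 := hind s₂ (by simp [hR]) t₂ (by simp [hR]) h22
    have i4 := hind t₂ (by simp [hR]) s₂ (by simp [hR]) h22.symm
    rw [G.adj_comm] at i2 i4
    have : ∀ f : V → ℕ, ∑ v ∈ R, f v = f s₁ + f t₁ + f s₂ + f t₂ := by
      intro f
      rw [hR, Finset.sum_insert, Finset.sum_insert, Finset.sum_insert, Finset.sum_singleton]
      · ring
      all_goals simp [*]
      exact h21.symm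
    rw [this]
    omega
  simp only [hdeg, Finset.sum_add_distrib] at hsum
  rw [hcomm] at hsum
  obtain ⟨l₁, l₂, hl₁, hl₂, hc⟩ := G.exists_cover_of_few_nonadjacent hs ht h11 h12 h21 h22 _ Rᶜ rfl
    (disjoint_compl_left (a := R)) (by
      rw [← hR, Finset.sum_add_distrib, ← Finset.mul_sum]
      omega) (by
      -- A missing triangle on three inner vertices requires seven vertices and three missing edges.
      rintro ⟨h3, hadj⟩
      have hc7 : Fintype.card V = 7 := by omega
      have hall : ∀ v ∈ Rᶜ, (Rᶜ.filter (Gᶜ.Adj v)).card = 2 := by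
        intro v hv
        have : Rᶜ.filter (Gᶜ.Adj v) = Rᶜ.erase v := by
          ext w
          simp only [Finset.mem_filter, Finset.mem_erase]
          exact ⟨fun h => ⟨h.2.ne', h.1⟩, fun h => ⟨h.2, hadj v hv w h.2 h.1.symm⟩⟩
        rw [this, Finset.card_erase_of_mem hv, h3]
      have : ∑ v ∈ Rᶜ, (Rᶜ.filter (Gᶜ.Adj v)).card = 6 := by
        rw [Finset.sum_congr rfl hall, Finset.sum_const, h3]; rfl
      have := h7 hc7
      omega)
  refine ⟨l₁, l₂, hl₁, hl₂, fun v => ?_⟩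
  rw [hc]
  simp [hR]
  tauto

end Complete

/-! ### Hamiltonian cycles and common neighbours in dense graphs -/

section Dense

variable {I : Type*} [DecidableEq I]

/-- A vertex set `S` in which at most `|S| - 3` adjacencies are missing carries a Hamiltonian
cycle, given here by its successor function. -/
theorem SimpleGraph.exists_cyclic_successor (Q : SimpleGraph I) [DecidableRel Q.Adj] (m : ℕ) :
    ∀ S : Finset I, S.card = m + 3 →
      ∑ v ∈ S, (S.filter (Qᶜ.Adj v)).card ≤ 2 * m →
      ∃ σ : I → I, (∀ x ∈ S, σ x ∈ S) ∧ Set.InjOn σ S ∧ (∀ x ∈ S, Q.Adj x (σ x)) ∧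
        ∀ C ⊆ S, C.Nonempty → (∀ x ∈ C, σ x ∈ C) → C = S := by
  induction m with
  | zero =>
    intro S hS hsum
    obtain ⟨a, b, c, hab, hac, hbc, rfl⟩ := Finset.card_eq_three.1 hS
    have hadj : ∀ u ∈ ({a, b, c} : Finset I), ∀ v ∈ ({a, b, c} : Finset I), u ≠ v → Q.Adj u v := by
      intro u hu v hv huv
      by_contra h
      have h0 := (Finset.sum_eq_zero_iff.1 (Nat.le_zero.1 hsum)) u hu
      rw [Finset.card_eq_zero] at h0
      exact Finset.notMem_empty v (h0 ▸ Finset.mem_filter.2 ⟨hv, huv, h⟩)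
    refine ⟨fun x => if x = a then b else if x = b then c else a, ?_, ?_, ?_, ?_⟩
    · intro x _
      change (if x = a then b else if x = b then c else a) ∈ _
      split_ifs <;> simp
    · intro x hx y hy hxy
      simp only [Finset.coe_insert, Finset.coe_singleton, Set.mem_insert_iff,
        Set.mem_singleton_iff] at hx hy
      grind
    · intro x hx
      refine hadj x hx _ ?_ ?_
      · change (if x = a then b else if x = b then c else a) ∈ _
        split_ifs <;> simp
      · simp only [Finset.mem_insert, Finset.mem_singleton] at hx
        grind
    · intro C hC hne hcl
      have ha : a ∈ C → b ∈ C := fun h => by simpa using hcl a h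
      have hb : b ∈ C → c ∈ C := fun h => by simpa [hab.symm] using hcl b h
      have hc : c ∈ C → a ∈ C := fun h => by simpa [hac.symm, hbc.symm] using hcl c h
      refine Finset.Subset.antisymm hC ?_
      obtain ⟨x, hx⟩ := hne
      have := hC hx
      simp only [Finset.mem_insert, Finset.mem_singleton] at this
      intro y hy
      simp only [Finset.mem_insert, Finset.mem_singleton] at hy
      grind
  | succ m ih =>
    intro S hS hsum
    have hv : ∃ v ∈ S, 2 * (S.filter (Qᶜ.Adj v)).card ≤ m + 2 ∧
        ∑ w ∈ S, (S.filter (Qᶜ.Adj w)).card ≤ 2 * m + 2 * (S.filter (Qᶜ.Adj v)).card := by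
      set P := S.filter fun v => 0 < (S.filter (Qᶜ.Adj v)).card with hP
      by_cases hne : P.Nonempty
      · obtain ⟨v, hv, hmin⟩ := Finset.exists_min_image P (fun v => (S.filter (Qᶜ.Adj v)).card) hne
        have hv' := Finset.mem_filter.1 hv
        refine ⟨v, hv'.1, ?_, by omega⟩
        have h1 : (S.filter (Qᶜ.Adj v)).card ≤ P.card - 1 := by
          rw [← Finset.card_erase_of_mem hv]
          refine Finset.card_le_card fun u hu => ?_
          rw [Finset.mem_filter] at hu
          exact Finset.mem_erase.2 ⟨hu.2.ne', Finset.mem_filter.2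
            ⟨hu.1, Finset.card_pos.2 ⟨v, Finset.mem_filter.2 ⟨hv'.1, hu.2.symm⟩⟩⟩⟩
        have h2 := Finset.card_nsmul_le_sum P _ _ hmin
        have h3 := h2.trans ((Finset.sum_le_sum_of_subset (Finset.filter_subset _ _)).trans hsum)
        rw [smul_eq_mul] at h3
        have h4 : 1 ≤ P.card := hne.card_pos
        -- At least `d + 1` vertices have missing degree at least `d`, so `d (d + 1) ≤ 2 (m + 1)`.
        -- Together with `2 d ≥ m + 3` this gives `d ^ 2 - 3 d + 4 ≤ 0`, which is impossible.
        by_contra! hlt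
        set d := (S.filter (Qᶜ.Adj v)).card
        have h5 : (d + 1) * d ≤ P.card * d := Nat.mul_le_mul_right _ (by omega)
        nlinarith
      · obtain ⟨v, hv⟩ : S.Nonempty := Finset.card_pos.1 (by omega)
        have h0 : ∀ w ∈ S, (S.filter (Qᶜ.Adj w)).card = 0 := by
          intro w hw
          by_contra h
          exact hne ⟨w, Finset.mem_filter.2 ⟨hw, Nat.pos_of_ne_zero h⟩⟩
        refine ⟨v, hv, by rw [h0 v hv]; omega, ?_⟩
        rw [Finset.sum_eq_zero h0]
        omega
    obtain ⟨v, hv, hd, hs⟩ := hv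
    have hcard : (S.erase v).card = m + 3 := by rw [Finset.card_erase_of_mem hv]; omega
    have hb : ∀ w ∈ S.erase v, (S.filter (Qᶜ.Adj w)).card =
        ((S.erase v).filter (Qᶜ.Adj w)).card + if Qᶜ.Adj v w then 1 else 0 := by
      intro w hw
      rw [Finset.card_filter, ← Finset.add_sum_erase _ _ hv, Finset.card_filter, add_comm]
      simp only [Qᶜ.adj_comm w v]
    have hbv : (S.filter (Qᶜ.Adj v)).card = ∑ w ∈ S.erase v, if Qᶜ.Adj v w then 1 else 0 := by
      rw [Finset.card_filter, ← Finset.add_sum_erase _ _ hv]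
      simp
    obtain ⟨σ, h1, h2, h3, h4⟩ := ih (S.erase v) hcard (by
      rw [← Finset.add_sum_erase _ _ hv, Finset.sum_congr rfl hb, Finset.sum_add_distrib,
        ← hbv] at hs
      omega)
    set T := (S.erase v).filter (Q.Adj v) with hT
    have hTcard : T.card + (S.filter (Qᶜ.Adj v)).card = m + 3 := by
      rw [← hcard, ← Finset.card_filter_add_card_filter_not (s := S.erase v) (Q.Adj v)]
      congr 2
      ext w
      simp only [Finset.mem_filter, Finset.mem_erase, SimpleGraph.compl_adj]
      exact ⟨fun h => ⟨⟨h.2.1.symm, h.1⟩, h.2.2⟩, fun h => ⟨h.1.2, h.1.1.symm, h.2⟩⟩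
    have hTS : T ⊆ S.erase v := Finset.filter_subset _ _
    -- The neighbourhood `T` of `v` has more than half of the vertices of the cycle, so it meets its
    -- shift `σ T`: some `x` and `σ x` are both neighbours of `v`, and `v` goes in between.
    obtain ⟨y, hy⟩ : (T ∩ T.image σ).Nonempty := by
      apply Finset.inter_nonempty_of_card_lt_card_add_card hTS
        (Finset.image_subset_iff.2 fun x hx => h1 x (hTS hx))
      rw [Finset.card_image_of_injOn (h2.mono (by exact_mod_cast hTS)), hcard]
      omega
    obtain ⟨hyT, hyσ⟩ := Finset.mem_inter.1 hy
    obtain ⟨x, hxT, rfl⟩ := Finset.mem_image.1 hyσ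
    have hx := Finset.mem_erase.1 (hTS hxT)
    have hσx := Finset.mem_erase.1 (hTS hyT)
    have hvx : Q.Adj v x := (Finset.mem_filter.1 hxT).2
    have hvy : Q.Adj v (σ x) := (Finset.mem_filter.1 hyT).2
    set τ : I → I := fun z => if z = v then σ x else if z = x then v else σ z with hτ
    have τv : τ v = σ x := by simp [hτ]
    have τx : τ x = v := by simp [hτ, hx.1]
    have τo : ∀ z, z ≠ v → z ≠ x → τ z = σ z := fun z h h' => by simp [hτ, h, h']
    refine ⟨τ, ?_, ?_, ?_, ?_⟩
    · intro z hz
      by_cases hzv : z = v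
      · rw [hzv, τv]; exact hσx.2
      · by_cases hzx : z = x
        · rw [hzx, τx]; exact hv
        · rw [τo z hzv hzx]; exact (Finset.mem_erase.1 (h1 z (Finset.mem_erase.2 ⟨hzv, hz⟩))).2
    · intro z hz w hw hzw
      have hS' : ∀ u, u ≠ v → u ∈ S → σ u ≠ v := fun u hu hu' =>
        (Finset.mem_erase.1 (h1 u (Finset.mem_erase.2 ⟨hu, hu'⟩))).1
      have hinj : ∀ u w, u ≠ v → u ∈ S → w ≠ v → w ∈ S → σ u = σ w → u = w :=
        fun u w hu hu' hw hw' h => h2 (by simp [hu, hu']) (by simp [hw, hw']) h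
      have hz' : z ∈ S := hz
      have hw' : w ∈ S := hw
      simp only [hτ] at hzw
      grind
    · intro z hz
      by_cases hzv : z = v
      · rw [hzv, τv]; exact hvy
      · by_cases hzx : z = x
        · rw [hzx, τx]; exact hvx.symm
        · rw [τo z hzv hzx]; exact h3 z (Finset.mem_erase.2 ⟨hzv, hz⟩)
    · intro C hC hne hcl
      have hC' : C.erase v = S.erase v := by
        refine h4 _ (Finset.erase_subset_erase v hC) ?_ ?_
        · obtain ⟨z, hz⟩ := hne
          by_cases hzv : z = v
          · subst hzv
            exact ⟨σ x, Finset.mem_erase.2 ⟨hσx.1, τv ▸ hcl z hz⟩⟩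
          · exact ⟨z, Finset.mem_erase.2 ⟨hzv, hz⟩⟩
        · intro z hz
          obtain ⟨hzv, hzC⟩ := Finset.mem_erase.1 hz
          by_cases hzx : z = x
          · rw [hzx] at hzC ⊢
            have := hcl x hzC
            rw [τx] at this
            exact Finset.mem_erase.2 ⟨hσx.1, τv ▸ hcl v this⟩
          · refine Finset.mem_erase.2 ⟨?_, τo z hzv hzx ▸ hcl z hzC⟩
            exact (Finset.mem_erase.1 (h1 z (Finset.mem_erase.2 ⟨hzv, hC hzC⟩))).1
      have hxC : x ∈ C := (Finset.mem_erase.1 (hC' ▸ hTS hxT)).2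
      have hvC : v ∈ C := τx ▸ hcl x hxC
      rw [← Finset.insert_erase hvC, hC', Finset.insert_erase hv]

variable [Fintype I]

theorem SimpleGraph.exists_cyclic_successor_univ (Q : SimpleGraph I) [DecidableRel Q.Adj]
    (h : Qᶜ.edgeFinset.card + 3 ≤ Fintype.card I) :
    ∃ σ : I → I, (∀ x, Q.Adj x (σ x)) ∧
      ∀ C : Finset I, C.Nonempty → (∀ x ∈ C, σ x ∈ C) → C = Finset.univ := by
  have hdeg : ∀ v, (Finset.univ.filter (Qᶜ.Adj v)).card = Qᶜ.degree v := fun v => by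
    rw [← SimpleGraph.card_neighborFinset_eq_degree]
    congr 1; ext; simp
  obtain ⟨σ, -, -, h3, h4⟩ := Q.exists_cyclic_successor (Fintype.card I - 3) Finset.univ
    (by rw [Finset.card_univ]; omega) (by
      simp only [hdeg]
      rw [Qᶜ.sum_degrees_eq_twice_card_edges]
      omega)
  exact ⟨σ, fun x => h3 x (Finset.mem_univ x), fun C => h4 C (Finset.subset_univ C)⟩

/-- Among the vertices outside of `K`, those not adjacent to all of `K` are fewer than the missing
edges not in `D`, if `D` consists of missing edges inside of `K`. -/
theorem SimpleGraph.card_le_card_adj_all (Q : SimpleGraph I) [DecidableRel Q.Adj] (K : Finset I)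
    (D : Finset (Sym2 I)) (hD : D ⊆ Qᶜ.edgeFinset) (hDK : ∀ e ∈ D, ∀ x ∈ e, x ∈ K) :
    Kᶜ.card + D.card ≤ Qᶜ.edgeFinset.card + (Kᶜ.filter fun y => ∀ x ∈ K, Q.Adj y x).card := by
  set N := Kᶜ.filter fun y => ¬ ∀ x ∈ K, Q.Adj y x with hN
  -- Each `y` in `N` is charged with one missing edge from `y` to `K`. These edges are distinct, and
  -- they leave `K`, so they are not in `D`.
  have hex : ∀ y ∈ N, ∃ x ∈ K, ¬ Q.Adj y x := fun y hy => by
    simpa using (Finset.mem_filter.1 hy).2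
  choose! f hfK hf using hex
  have hNK : ∀ y ∈ N, y ∉ K := fun y hy => Finset.mem_compl.1 (Finset.mem_filter.1 hy).1
  have hinj : Set.InjOn (fun y => s(y, f y)) (N : Set I) := by
    intro y hy z hz hyz
    simp only [Sym2.eq_iff] at hyz
    rcases hyz with h | h
    · exact h.1
    · exact absurd (h.1 ▸ hfK z hz) (hNK y hy)
  have hdisj : Disjoint (N.image fun y => s(y, f y)) D := by
    rw [Finset.disjoint_left]
    intro e he heD
    obtain ⟨y, hy, rfl⟩ := Finset.mem_image.1 he
    exact hNK y hy (hDK _ heD y (by simp))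
  have hsub : (N.image fun y => s(y, f y)) ∪ D ⊆ Qᶜ.edgeFinset := by
    refine Finset.union_subset (fun e he => ?_) hD
    obtain ⟨y, hy, rfl⟩ := Finset.mem_image.1 he
    rw [SimpleGraph.mem_edgeFinset, SimpleGraph.mem_edgeSet]
    exact ⟨fun h => hNK y hy (h ▸ hfK y hy), hf y hy⟩
  have h1 := Finset.card_le_card hsub
  rw [Finset.card_union_of_disjoint hdisj, Finset.card_image_of_injOn hinj] at h1
  have h2 : (Kᶜ.filter fun y => ∀ x ∈ K, Q.Adj y x).card + N.card = Kᶜ.card := by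
    rw [← Finset.card_filter_add_card_filter_not (s := Kᶜ) fun y => ∀ x ∈ K, Q.Adj y x, hN]
  omega

end Dense

/-! ### Layers of a graph on a product, and covers of sets of layers -/

theorem List.ConsecIn.symm {V : Type*} {l₁ l₂ : List V} {a b : V} (h : List.ConsecIn l₁ l₂ a b) :
    List.ConsecIn l₂ l₁ a b := Or.symm h

theorem List.ConsecIn.append {V : Type*} {l₁ l₂ : List V} {a b : V} (h : List.ConsecIn l₁ l₂ a b)
    (m₁ m₂ : List V) : List.ConsecIn (l₁ ++ m₁) (l₂ ++ m₂) a b :=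
  h.imp (fun h => h.trans ⟨[], m₁, by simp⟩) fun h => h.trans ⟨[], m₂, by simp⟩

theorem List.ConsecIn.append_left {V : Type*} {l₁ l₂ : List V} {a b : V}
    (h : List.ConsecIn l₁ l₂ a b) (m₁ m₂ : List V) :
    List.ConsecIn (m₁ ++ l₁) (m₂ ++ l₂) a b :=
  h.imp (fun h => h.trans ⟨m₁, [], by simp⟩) fun h => h.trans ⟨m₂, [], by simp⟩

theorem List.ConsecIn.reverse_left {V : Type*} {l₁ l₂ : List V} {a b : V}
    (h : List.ConsecIn l₁ l₂ a b) :
    List.ConsecIn l₁.reverse l₂ b a ∨ List.ConsecIn l₁.reverse l₂ a b :=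
  h.imp (fun h => Or.inl (by simpa using List.reverse_infix.2 h)) Or.inr

theorem List.ConsecIn.adj {V : Type*} {G : SimpleGraph V} {s₁ t₁ s₂ t₂ : V} {l₁ l₂ : List V}
    {a b : V} (h : List.ConsecIn l₁ l₂ a b) (hl₁ : G.IsWalkList s₁ t₁ l₁)
    (hl₂ : G.IsWalkList s₂ t₂ l₂) : G.Adj a b := by
  rcases h with ⟨A, B, rfl⟩ | ⟨A, B, rfl⟩
  · exact (SimpleGraph.IsWalkList.split (l₁ := A) (l₂ := B) (by simpa using hl₁)).2.2
  · exact (SimpleGraph.IsWalkList.split (l₁ := A) (l₂ := B) (by simpa using hl₂)).2.2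

namespace SimpleGraph

variable {I V : Type*}

/-- The subgraph of a graph on `I × V` on the vertices with first component `α`. -/
abbrev layer (G : SimpleGraph (I × V)) (α : I) : SimpleGraph V := G.comap (Prod.mk α)

theorem IsWalkList.of_layer {G : SimpleGraph (I × V)} {α : I} {s t : V} {l : List V} (h : (G.layer α).IsWalkList s t l) :
    G.IsWalkList (α, s) (α, t) (l.map (Prod.mk α)) :=
  h.map _ fun _ _ h => h

theorem count_map_mk [DecidableEq I] [DecidableEq V] (α : I) (l : List V) (p : I × V) :
    (l.map (Prod.mk α)).count p = if p.1 = α then l.count p.2 else 0 := by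
  obtain ⟨β, v⟩ := p
  split_ifs with h
  · simp only at h
    subst h
    exact List.count_map_of_injective _ _ (Prod.mk_right_injective β) v
  · rw [List.count_eq_zero]
    intro hm
    obtain ⟨w, -, hw⟩ := List.mem_map.1 hm
    exact h (congrArg Prod.fst hw).symm

variable [Fintype V]

open Classical in
/-- The positions at which the layers `α` and `β` are not joined. -/
noncomputable def crossFaults (G : SimpleGraph (I × V)) (α β : I) : Finset V :=
  Finset.univ.filter fun v => ¬ G.Adj (α, v) (β, v)

theorem mem_crossFaults {G : SimpleGraph (I × V)} {α β : I} {v : V} :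
    v ∈ G.crossFaults α β ↔ ¬ G.Adj (α, v) (β, v) := by
  simp [crossFaults]

theorem crossFaults_comm (G : SimpleGraph (I × V)) (α β : I) :
    G.crossFaults α β = G.crossFaults β α := by
  ext; simp only [mem_crossFaults, G.adj_comm]

/-- Two layers are adjacent if few of the edges between them are missing. -/
def layerGraph (G : SimpleGraph (I × V)) : SimpleGraph I where
  Adj α β := α ≠ β ∧ 2 * (G.crossFaults α β).card + 4 ≤ Fintype.card V
  symm := ⟨fun α β h => ⟨h.1.symm, by rw [crossFaults_comm]; exact h.2⟩⟩
  loopless := ⟨fun _ h => h.1 rfl⟩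

/-- Adjacent layers have at least `N / 2 + 2` intact crossings, `N` being the size of a layer.
Already for `N = 4` this allows three positions to be avoided; the constructions that avoid four or
five assume `8 ≤ N`. -/
theorem exists_crossing [DecidableEq V] {G : SimpleGraph (I × V)} {α β : I} (h : G.layerGraph.Adj α β) (Z : Finset V)
    (hZ : 2 * Z.card < Fintype.card V + 4) : ∃ u, u ∉ Z ∧ G.Adj (α, u) (β, u) := by
  have hlt : (G.crossFaults α β ∪ Z).card < Fintype.card V := by
    have := Finset.card_union_le (G.crossFaults α β) Z
    have := h.2
    omega
  obtain ⟨u, hu⟩ : ((G.crossFaults α β ∪ Z)ᶜ).Nonempty := by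
    rw [← Finset.card_pos, Finset.card_compl]; omega
  simp only [Finset.mem_compl, Finset.mem_union, not_or, mem_crossFaults, not_not] at hu
  exact ⟨u, hu.2, hu.1⟩

/-- The walks `l₁` and `l₂` contain many edges in the layer `α`. -/
def RichIn (V : Type*) [Fintype V] {I : Type*} (α : I) (l₁ l₂ : List (I × V)) : Prop :=
  ∀ X : Finset V, 2 * X.card + 4 ≤ Fintype.card V →
    ∃ u v, u ∉ X ∧ v ∉ X ∧ List.ConsecIn l₁ l₂ (α, u) (α, v)

variable [DecidableEq I] [DecidableEq V]

/-- `l₁` and `l₂` together contain every vertex of the layers in `C` once and no other vertex, and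
have many edges in each of these layers. -/
def LayerCover (C : Finset I) (l₁ l₂ : List (I × V)) : Prop :=
  (∀ p, l₁.count p + l₂.count p = if p.1 ∈ C then 1 else 0) ∧ ∀ γ ∈ C, RichIn V γ l₁ l₂

namespace LayerCover

variable {C D : Finset I} {l₁ l₂ m₁ m₂ l m : List (I × V)}

theorem symm (h : LayerCover C l₁ l₂) : LayerCover C l₂ l₁ := by
  refine ⟨fun p => by rw [add_comm]; exact h.1 p, fun γ hγ X hX => ?_⟩
  obtain ⟨u, v, hu, hv, huv⟩ := h.2 γ hγ X hX
  exact ⟨u, v, hu, hv, huv.symm⟩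

theorem reverse (h : LayerCover C l₁ l₂) : LayerCover C l₁.reverse l₂ := by
  refine ⟨fun p => by rw [List.count_reverse]; exact h.1 p, fun γ hγ X hX => ?_⟩
  obtain ⟨u, v, hu, hv, huv⟩ := h.2 γ hγ X hX
  rcases huv.reverse_left with h | h
  exacts [⟨v, u, hv, hu, h⟩, ⟨u, v, hu, hv, h⟩]

theorem append (h : LayerCover C l₁ l₂) (h' : LayerCover D m₁ m₂) (hCD : Disjoint C D) :
    LayerCover (C ∪ D) (l₁ ++ m₁) (l₂ ++ m₂) := by
  refine ⟨fun p => ?_, fun γ hγ X hX => ?_⟩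
  · have h1 := h.1 p
    have h2 := h'.1 p
    have h3 : p.1 ∈ C → p.1 ∉ D := fun h h' => Finset.disjoint_left.1 hCD h h'
    simp only [List.count_append, Finset.mem_union]
    split_ifs at h1 h2 ⊢ <;> first | omega | tauto
  · rcases Finset.mem_union.1 hγ with hγ | hγ
    · obtain ⟨u, v, hu, hv, huv⟩ := h.2 γ hγ X hX
      exact ⟨u, v, hu, hv, huv.append _ _⟩
    · obtain ⟨u, v, hu, hv, huv⟩ := h'.2 γ hγ X hX
      exact ⟨u, v, hu, hv, huv.append_left _ _⟩

theorem append_fst (h : LayerCover C l₁ l₂) (h' : LayerCover D m []) (hCD : Disjoint C D) :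
    LayerCover (C ∪ D) (l₁ ++ m) l₂ := by
  simpa using h.append h' hCD

theorem append_snd (h : LayerCover C l₁ l₂) (h' : LayerCover D m []) (hCD : Disjoint C D) :
    LayerCover (C ∪ D) l₁ (l₂ ++ m) := by
  simpa using h.append h'.symm hCD

end LayerCover

/-- Some nonempty set of layers is covered by two disjoint paths with the given ends. -/
def HasLayerCover (G : SimpleGraph (I × V)) (s₁ t₁ s₂ t₂ : I × V) : Prop :=
  ∃ (C : Finset I) (l₁ l₂ : List (I × V)), C.Nonempty ∧ G.IsWalkList s₁ t₁ l₁ ∧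
    G.IsWalkList s₂ t₂ l₂ ∧ LayerCover C l₁ l₂

theorem HasLayerCover.swap {G : SimpleGraph (I × V)} {s₁ t₁ s₂ t₂ : I × V}
    (h : G.HasLayerCover s₁ t₁ s₂ t₂) : G.HasLayerCover s₂ t₂ s₁ t₁ := by
  obtain ⟨C, l₁, l₂, hC, h1, h2, h3⟩ := h
  exact ⟨C, l₂, l₁, hC, h2, h1, h3.symm⟩

theorem HasLayerCover.reverse_fst {G : SimpleGraph (I × V)} {s₁ t₁ s₂ t₂ : I × V}
    (h : G.HasLayerCover s₁ t₁ s₂ t₂) : G.HasLayerCover t₁ s₁ s₂ t₂ := by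
  obtain ⟨C, l₁, l₂, hC, h1, h2, h3⟩ := h
  exact ⟨C, _, l₂, hC, h1.reverse, h2, h3.reverse⟩

theorem HasLayerCover.reverse_snd {G : SimpleGraph (I × V)} {s₁ t₁ s₂ t₂ : I × V}
    (h : G.HasLayerCover s₁ t₁ s₂ t₂) : G.HasLayerCover s₁ t₁ t₂ s₂ :=
  h.swap.reverse_fst.swap

variable {G : SimpleGraph (I × V)}

/-- The cover is rich because two disjoint paths through all `N` vertices have `N - 2` edges, of
which `X` meets at most `2 |X| ≤ N - 4`. -/
theorem exists_layer_pair (hL : ∀ α, (G.layer α).IsPairedTwoDPC) (α : I) {x₁ y₁ x₂ y₂ : V}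
    (hx : x₁ ≠ x₂) (hy : y₁ ≠ y₂) (h11 : x₁ ≠ y₁) (h12 : x₁ ≠ y₂) (h21 : x₂ ≠ y₁)
    (h22 : x₂ ≠ y₂) : ∃ l₁ l₂, G.IsWalkList (α, x₁) (α, y₁) l₁ ∧
      G.IsWalkList (α, x₂) (α, y₂) l₂ ∧ LayerCover {α} l₁ l₂ := by
  obtain ⟨l₁, l₂, hl₁, hl₂, hc⟩ := (hL α).exists_lists hx hy h11 h12 h21 h22
  refine ⟨_, _, hl₁.of_layer, hl₂.of_layer, fun p => ?_, fun γ hγ X hX => ?_⟩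
  · rw [count_map_mk, count_map_mk]
    by_cases h : p.1 = α <;> simp [h, hc]
  · rw [Finset.mem_singleton] at hγ
    subst hγ
    obtain ⟨u, v, hu, hv, huv⟩ := exists_consecIn_avoiding hl₁ hl₂ Finset.univ (by simpa using hc)
      (fun v => v ∈ X) (by
        rw [Finset.card_univ]
        have : (Finset.univ.filter fun v => v ∈ X) = X := by ext; simp
        rw [this]; omega)
    exact ⟨u, v, hu, hv, huv.imp (fun h => h.map (Prod.mk γ)) fun h => h.map (Prod.mk γ)⟩

theorem exists_layer_path (hL : ∀ α, (G.layer α).IsPairedTwoDPC) (hV : 4 ≤ Fintype.card V) (α : I)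
    {x y : V} (hxy : x ≠ y) : ∃ l, G.IsWalkList (α, x) (α, y) l ∧ LayerCover {α} l [] := by
  obtain ⟨l, hl, hc⟩ := (hL α).exists_hamiltonian_list hV hxy
  refine ⟨_, hl.of_layer, fun p => ?_, fun γ hγ X hX => ?_⟩
  · rw [count_map_mk]
    by_cases h : p.1 = α <;> simp [h, hc]
  · rw [Finset.mem_singleton] at hγ
    subst hγ
    by_contra! hcon
    have h1 := hl.length_add_le (fun v => v ∈ X) fun u v huv => by
      by_contra! h
      exact hcon u v h.1 h.2 (Or.inl (huv.map (Prod.mk γ)))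
    have h2 : l.length = Fintype.card V := by
      rw [List.length_eq_sum_count]; simp [hc]
    have h3 : l.countP (fun v => v ∈ X) = X.card := by
      rw [List.countP_eq_sum_count]; simp [hc]
    rw [h2, h3] at h1
    omega

theorem exists_link (hL : ∀ α, (G.layer α).IsPairedTwoDPC) (hV : 4 ≤ Fintype.card V) {α β : I}
    (h : G.layerGraph.Adj α β) (x y : V) :
    ∃ l, G.IsWalkList (α, x) (β, y) l ∧ LayerCover {α, β} l [] := by
  obtain ⟨u, hu, hadj⟩ := exists_crossing h {x, y} (by
    have := Finset.card_le_two (a := x) (b := y); omega)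
  simp only [Finset.mem_insert, Finset.mem_singleton, not_or] at hu
  obtain ⟨l, hl, hl'⟩ := exists_layer_path hL hV α (Ne.symm hu.1)
  obtain ⟨m, hm, hm'⟩ := exists_layer_path hL hV β hu.2
  exact ⟨l ++ m, hl.append hadj hm, hl'.append_fst hm' (by simpa using h.ne)⟩

theorem exists_link_via (hL : ∀ α, (G.layer α).IsPairedTwoDPC) (hV : 4 ≤ Fintype.card V)
    {α β γ : I} (h : G.layerGraph.Adj α β) (h' : G.layerGraph.Adj β γ) (hαγ : α ≠ γ) (x y : V) :
    ∃ l, G.IsWalkList (α, x) (γ, y) l ∧ LayerCover ({α, β} ∪ {γ}) l [] := by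
  obtain ⟨u, hu, hadj⟩ := exists_crossing h' {y} (by rw [Finset.card_singleton]; omega)
  rw [Finset.mem_singleton] at hu
  obtain ⟨l, hl, hl'⟩ := exists_link hL hV h x u
  obtain ⟨m, hm, hm'⟩ := exists_layer_path hL hV γ hu
  exact ⟨l ++ m, hl.append hadj hm, hl'.append_fst hm' (by simp [hαγ.symm, h'.ne.symm])⟩

/-- Two disjoint paths that cover some of the layers can be extended to the remaining layers. -/
theorem exists_cover_of_cyclic_successor [Fintype I] (hL : ∀ α, (G.layer α).IsPairedTwoDPC)
    (hV : 4 ≤ Fintype.card V) {σ : I → I} (hσ : ∀ x, G.layerGraph.Adj x (σ x))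
    (hcyc : ∀ C : Finset I, C.Nonempty → (∀ x ∈ C, σ x ∈ C) → C = Finset.univ)
    {s₁ t₁ s₂ t₂ : I × V} (m : ℕ) :
    ∀ (C : Finset I) (l₁ l₂ : List (I × V)), Cᶜ.card = m → C.Nonempty →
      G.IsWalkList s₁ t₁ l₁ → G.IsWalkList s₂ t₂ l₂ →
      (∀ p, l₁.count p + l₂.count p = if p.1 ∈ C then 1 else 0) →
      (∀ γ ∈ C, σ γ ∉ C → RichIn V γ l₁ l₂) →
      ∃ l₁' l₂', G.IsWalkList s₁ t₁ l₁' ∧ G.IsWalkList s₂ t₂ l₂' ∧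
        ∀ p, l₁'.count p + l₂'.count p = 1 := by
  induction m with
  | zero =>
    intro C l₁ l₂ hC _ hl₁ hl₂ hc _
    rw [Finset.card_eq_zero, Finset.compl_eq_empty_iff] at hC
    subst hC
    exact ⟨l₁, l₂, hl₁, hl₂, by simpa using hc⟩
  | succ m ih =>
    intro C l₁ l₂ hC hne hl₁ hl₂ hc hrich
    obtain ⟨x, hx, hσx⟩ : ∃ x ∈ C, σ x ∉ C := by
      by_contra! h
      rw [hcyc C hne h] at hC
      simp at hC
    -- Richness yields an edge of the paths in layer `x` whose two ends both have intact crossings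
    -- to the layer `σ x`.
    obtain ⟨u, v, hu, hv, huv⟩ := hrich x hx hσx (G.crossFaults x (σ x)) (hσ x).2
    rw [mem_crossFaults, not_not] at hu hv
    have huv' : u ≠ v := by
      rintro rfl
      exact (huv.adj hl₁ hl₂).ne rfl
    obtain ⟨d, hd, hd'⟩ := exists_layer_path hL hV (σ x) huv'
    obtain ⟨l₁', l₂', h1, h2, h3, h4, h5⟩ := exists_detour hl₁ hl₂ huv hd hu hv.symm
    refine ih (insert (σ x) C) l₁' l₂' ?_ (by simp) h1 h2 ?_ ?_
    · rw [Finset.compl_insert, Finset.card_erase_of_mem (by simpa using hσx)]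
      omega
    · intro p
      have h6 := hd'.1 p
      rw [List.count_nil, add_zero] at h6
      rw [h3, hc, h6]
      by_cases hp : p.1 = σ x
      · simp [hp, hσx]
      · simp [hp]
    · intro γ hγ hσγ X hX
      rcases Finset.mem_insert.1 hγ with rfl | hγ
      · obtain ⟨a, b, ha, hb, hab⟩ := hd'.2 (σ x) (by simp) X hX
        refine ⟨a, b, ha, hb, h4 _ _ (hab.resolve_right fun h => ?_)⟩
        simpa using h.length_le
      · obtain ⟨a, b, ha, hb, hab⟩ := hrich γ hγ (fun h => hσγ (Finset.mem_insert_of_mem h)) X hX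
        refine ⟨a, b, ha, hb, h5 _ _ ?_ hab⟩
        -- Only layer `x` loses an edge, and its successor is now covered, so its richness is no
        -- longer needed.
        rintro h
        have : γ = x := congrArg Prod.fst h
        subst this
        exact hσγ (Finset.mem_insert_self _ _)

end SimpleGraph

/-! ### Routing patterns for the layers of the terminals -/

namespace SimpleGraph

variable {I V : Type*} [Fintype V] [DecidableEq V] [DecidableEq I] {G : SimpleGraph (I × V)}

theorem HasLayerCover.of_disjoint {s₁ t₁ s₂ t₂ : I × V} {C D : Finset I} {l m : List (I × V)}
    (hC : C.Nonempty) (hl : G.IsWalkList s₁ t₁ l) (hl' : LayerCover C l [])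
    (hm : G.IsWalkList s₂ t₂ m) (hm' : LayerCover D m []) (hCD : Disjoint C D) :
    G.HasLayerCover s₁ t₁ s₂ t₂ :=
  ⟨C ∪ D, l, m, hC.mono Finset.subset_union_left, hl, hm, by simpa using hl'.append_snd hm' hCD⟩

/-- The paths use the layer `α`, the links use other layers. -/
theorem HasLayerCover.of_layer_pair {α : I} {a b c d s₁ t₁ s₂ t₂ : I × V} {C D : Finset I}
    {l₁ l₂ m₁ m₂ : List (I × V)} (hl₁ : G.IsWalkList s₁ a l₁) (hl₂ : G.IsWalkList s₂ b l₂)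
    (hl : LayerCover {α} l₁ l₂) (hac : G.Adj a c) (hbd : G.Adj b d)
    (hm₁ : G.IsWalkList c t₁ m₁) (hm₁' : LayerCover C m₁ []) (hm₂ : G.IsWalkList d t₂ m₂)
    (hm₂' : LayerCover D m₂ []) (hC : α ∉ C) (hD : α ∉ D) (hCD : Disjoint C D) :
    G.HasLayerCover s₁ t₁ s₂ t₂ := by
  refine ⟨{α} ∪ C ∪ D, _, _, ⟨α, by simp⟩, hl₁.append hac hm₁, hl₂.append hbd hm₂,
    (hl.append_fst hm₁' (by simpa)).append_snd hm₂' ?_⟩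
  rw [Finset.disjoint_union_left]
  exact ⟨by simpa, hCD⟩

theorem hasLayerCover_of_three_one (hL : ∀ α, (G.layer α).IsPairedTwoDPC)
    (hV : 4 ≤ Fintype.card V) {α β γ : I} (hαγ : G.layerGraph.Adj α γ)
    (hγβ : G.layerGraph.Adj γ β) (hαβ : α ≠ β) {x₁ y₁ x₂ y₂ : V} (h1 : x₁ ≠ y₁) (h2 : x₁ ≠ x₂)
    (h3 : x₂ ≠ y₁) : G.HasLayerCover (α, x₁) (α, y₁) (α, x₂) (β, y₂) := by
  obtain ⟨u, hu, hadj⟩ := exists_crossing hαγ {x₁, y₁, x₂} (by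
    have := Finset.card_le_three (a := x₁) (b := y₁) (c := x₂); omega)
  simp only [Finset.mem_insert, Finset.mem_singleton, not_or] at hu
  obtain ⟨l₁, l₂, hl₁, hl₂, hl⟩ := exists_layer_pair hL α h2 (Ne.symm hu.2.1) h1 (Ne.symm hu.1) h3
    (Ne.symm hu.2.2)
  obtain ⟨m, hm, hm'⟩ := exists_link hL hV hγβ u y₂
  exact ⟨_, l₁, l₂ ++ m, ⟨α, by simp⟩, hl₁, hl₂.append hadj hm,
    hl.append_snd hm' (by simpa using ⟨hαγ.ne, hαβ⟩)⟩

/-- Each path has an intermediate layer of its own, so never more than three positions are avoided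
and layers of size 4 suffice. -/
theorem hasLayerCover_of_two_two_of_two_common (hL : ∀ α, (G.layer α).IsPairedTwoDPC)
    (hV : 4 ≤ Fintype.card V) {α β γ δ : I} (hαβ : α ≠ β) (hγδ : γ ≠ δ)
    (hαγ : G.layerGraph.Adj α γ) (hγβ : G.layerGraph.Adj γ β) (hαδ : G.layerGraph.Adj α δ)
    (hδβ : G.layerGraph.Adj δ β) {x₁ y₁ x₂ y₂ : V} (hx : x₁ ≠ x₂) (hy : y₁ ≠ y₂) :
    G.HasLayerCover (α, x₁) (β, y₁) (α, x₂) (β, y₂) := by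
  obtain ⟨u, hu, hadju⟩ := exists_crossing hαγ {x₁, x₂} (by
    have := Finset.card_le_two (a := x₁) (b := x₂); omega)
  obtain ⟨v, hv, hadjv⟩ := exists_crossing hαδ {x₁, x₂, u} (by
    have := Finset.card_le_three (a := x₁) (b := x₂) (c := u); omega)
  -- The faults from `γ` and from `δ` to `β` occupy at most `N - 4` positions together, so at least
  -- four positions serve both layers.
  have hcross : ∀ Z : Finset V, Z.card ≤ 3 →
      ∃ a, a ∉ Z ∧ G.Adj (γ, a) (β, a) ∧ G.Adj (δ, a) (β, a) := by
    intro Z hZ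
    have hlt : (G.crossFaults γ β ∪ G.crossFaults δ β ∪ Z).card < Fintype.card V := by
      have := Finset.card_union_le (G.crossFaults γ β ∪ G.crossFaults δ β) Z
      have := Finset.card_union_le (G.crossFaults γ β) (G.crossFaults δ β)
      have := hγβ.2
      have := hδβ.2
      omega
    obtain ⟨a, ha⟩ : ((G.crossFaults γ β ∪ G.crossFaults δ β ∪ Z)ᶜ).Nonempty := by
      rw [← Finset.card_pos, Finset.card_compl]; omega
    simp only [Finset.mem_compl, Finset.mem_union, not_or, mem_crossFaults, not_not] at ha
    exact ⟨a, ha.2, ha.1⟩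
  obtain ⟨a, ha, haγ, haδ⟩ := hcross {y₁, y₂} (Finset.card_le_two.trans (by omega))
  obtain ⟨b, hb, hbγ, hbδ⟩ := hcross {y₁, y₂, a} Finset.card_le_three
  simp only [Finset.mem_insert, Finset.mem_singleton, not_or] at hu hv ha hb
  obtain ⟨c, d, hcu, hdv, hcd, hc, hd, hcγ, hdδ⟩ : ∃ c d, c ≠ u ∧ d ≠ v ∧ c ≠ d ∧
      (c ≠ y₁ ∧ c ≠ y₂) ∧ (d ≠ y₁ ∧ d ≠ y₂) ∧ G.Adj (γ, c) (β, c) ∧ G.Adj (δ, d) (β, d) := by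
    -- Both positions serve both layers, so a coincidence with `u` or `v` is removed by swapping
    -- them.
    by_cases h : a ≠ u ∧ b ≠ v
    · exact ⟨a, b, h.1, h.2, Ne.symm hb.2.2, ha, ⟨hb.1, hb.2.1⟩, haγ, hbδ⟩
    · refine ⟨b, a, ?_, ?_, hb.2.2, ⟨hb.1, hb.2.1⟩, ha, hbγ, haδ⟩ <;> grind
  obtain ⟨l₁, l₂, hl₁, hl₂, hl⟩ := exists_layer_pair hL α hx (Ne.symm hv.2.2) (Ne.symm hu.1)
    (Ne.symm hv.1) (Ne.symm hu.2) (Ne.symm hv.2.1)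
  obtain ⟨k₁, k₂, hk₁, hk₂, hk⟩ := exists_layer_pair hL β hcd hy hc.1 hc.2 hd.1 hd.2
  obtain ⟨m₁, hm₁, hm₁'⟩ := exists_layer_path hL hV γ (Ne.symm hcu)
  obtain ⟨m₂, hm₂, hm₂'⟩ := exists_layer_path hL hV δ (Ne.symm hdv)
  refine ⟨_, _, _, ⟨α, by simp⟩, (hl₁.append hadju hm₁).append hcγ hk₁,
    (hl₂.append hadjv hm₂).append hdδ hk₂,
    ((hl.append_fst hm₁' ?_).append_snd hm₂' ?_).append hk ?_⟩
  · simpa using hαγ.ne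
  · simp [hαδ.ne.symm, hγδ.symm]
  · simp [hαβ.symm, hγβ.ne.symm, hδβ.ne.symm]

/-- With a single common neighbour both paths pass through it; the four entry and exit positions
there must be distinct, which is why larger layers are assumed. -/
theorem hasLayerCover_of_two_two_of_common (hL : ∀ α, (G.layer α).IsPairedTwoDPC) (hV8 : 8 ≤ Fintype.card V) {α β γ : I} (hαβ : α ≠ β)
    (hαγ : G.layerGraph.Adj α γ) (hγβ : G.layerGraph.Adj γ β) {x₁ y₁ x₂ y₂ : V} (hx : x₁ ≠ x₂)
    (hy : y₁ ≠ y₂) : G.HasLayerCover (α, x₁) (β, y₁) (α, x₂) (β, y₂) := by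
  obtain ⟨u, hu, hadju⟩ := exists_crossing hαγ {x₁, x₂} (by
    have := Finset.card_le_two (a := x₁) (b := x₂); omega)
  obtain ⟨v, hv, hadjv⟩ := exists_crossing hαγ {x₁, x₂, u} (by
    have := Finset.card_le_three (a := x₁) (b := x₂) (c := u); omega)
  obtain ⟨c, hc, hadjc⟩ := exists_crossing hγβ {y₁, y₂, u, v} (by
    have := Finset.card_le_four (a := y₁) (b := y₂) (c := u) (d := v); omega)
  obtain ⟨d, hd, hadjd⟩ := exists_crossing hγβ {y₁, y₂, u, v, c} (by
    have := Finset.card_le_five (a := y₁) (b := y₂) (c := u) (d := v) (e := c); omega)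
  simp only [Finset.mem_insert, Finset.mem_singleton, not_or] at hu hv hc hd
  obtain ⟨l₁, l₂, hl₁, hl₂, hl⟩ := exists_layer_pair hL α hx (Ne.symm hv.2.2) (Ne.symm hu.1)
    (Ne.symm hv.1) (Ne.symm hu.2) (Ne.symm hv.2.1)
  obtain ⟨k₁, k₂, hk₁, hk₂, hk⟩ := exists_layer_pair hL γ (Ne.symm hv.2.2) (Ne.symm hd.2.2.2.2)
    (Ne.symm hc.2.2.1) (Ne.symm hd.2.2.1) (Ne.symm hc.2.2.2) (Ne.symm hd.2.2.2.1)
  obtain ⟨m₁, m₂, hm₁, hm₂, hm⟩ := exists_layer_pair hL β (Ne.symm hd.2.2.2.2) hy hc.1 hc.2.1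
    hd.1 hd.2.1
  refine ⟨_, _, _, ⟨α, by simp⟩, (hl₁.append hadju hk₁).append hadjc hm₁,
    (hl₂.append hadjv hk₂).append hadjd hm₂, (hl.append hk ?_).append hm ?_⟩
  · simpa using hαγ.ne
  · simp [hαβ.symm, hγβ.ne.symm]

theorem hasLayerCover_of_two_one_one_direct (hL : ∀ α, (G.layer α).IsPairedTwoDPC)
    (hV : 4 ≤ Fintype.card V) (hV8 : 8 ≤ Fintype.card V) {α β γ : I} (hβγ : β ≠ γ)
    (hαβ : G.layerGraph.Adj α β) (hαγ : G.layerGraph.Adj α γ) {x₁ y₁ x₂ y₂ : V} (hx : x₁ ≠ x₂) :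
    G.HasLayerCover (α, x₁) (β, y₁) (α, x₂) (γ, y₂) := by
  obtain ⟨u, hu, hadju⟩ := exists_crossing hαβ {x₁, x₂, y₁} (by
    have := Finset.card_le_three (a := x₁) (b := x₂) (c := y₁); omega)
  obtain ⟨v, hv, hadjv⟩ := exists_crossing hαγ {x₁, x₂, u, y₂} (by
    have := Finset.card_le_four (a := x₁) (b := x₂) (c := u) (d := y₂); omega)
  simp only [Finset.mem_insert, Finset.mem_singleton, not_or] at hu hv
  obtain ⟨l₁, l₂, hl₁, hl₂, hl⟩ := exists_layer_pair hL α hx (Ne.symm hv.2.2.1) (Ne.symm hu.1)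
    (Ne.symm hv.1) (Ne.symm hu.2.1) (Ne.symm hv.2.1)
  obtain ⟨m₁, hm₁, hm₁'⟩ := exists_layer_path hL hV β hu.2.2
  obtain ⟨m₂, hm₂, hm₂'⟩ := exists_layer_path hL hV γ hv.2.2.2
  exact .of_layer_pair hl₁ hl₂ hl hadju hadjv hm₁ hm₁' hm₂ hm₂' (by simpa using hαβ.ne)
    (by simpa using hαγ.ne) (by simpa using hβγ)

theorem hasLayerCover_of_two_one_one_via (hL : ∀ α, (G.layer α).IsPairedTwoDPC)
    (hV : 4 ≤ Fintype.card V) {α β γ δ : I} (hβγ : β ≠ γ)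
    (hαβ : G.layerGraph.Adj α β) (hαγ : α ≠ γ) (hβδ : β ≠ δ) (hαδ : G.layerGraph.Adj α δ)
    (hδγ : G.layerGraph.Adj δ γ) {x₁ y₁ x₂ y₂ : V} (hx : x₁ ≠ x₂) :
    G.HasLayerCover (α, x₁) (β, y₁) (α, x₂) (γ, y₂) := by
  obtain ⟨u, hu, hadju⟩ := exists_crossing hαβ {x₁, x₂, y₁} (by
    have := Finset.card_le_three (a := x₁) (b := x₂) (c := y₁); omega)
  obtain ⟨v, hv, hadjv⟩ := exists_crossing hαδ {x₁, x₂, u} (by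
    have := Finset.card_le_three (a := x₁) (b := x₂) (c := u); omega)
  simp only [Finset.mem_insert, Finset.mem_singleton, not_or] at hu hv
  obtain ⟨l₁, l₂, hl₁, hl₂, hl⟩ := exists_layer_pair hL α hx (Ne.symm hv.2.2) (Ne.symm hu.1)
    (Ne.symm hv.1) (Ne.symm hu.2.1) (Ne.symm hv.2.1)
  obtain ⟨m₁, hm₁, hm₁'⟩ := exists_layer_path hL hV β hu.2.2
  obtain ⟨m₂, hm₂, hm₂'⟩ := exists_link hL hV hδγ v y₂
  exact .of_layer_pair hl₁ hl₂ hl hadju hadjv hm₁ hm₁' hm₂ hm₂' (by simpa using hαβ.ne)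
    (by simp [hαγ, hαδ.ne]) (by simp [hβγ, hβδ])

theorem hasLayerCover_of_two_one_one_via_both (hL : ∀ α, (G.layer α).IsPairedTwoDPC)
    (hV : 4 ≤ Fintype.card V) {α β γ δ ε : I} (hβγ : β ≠ γ) (hαβ : α ≠ β)
    (hαγ : α ≠ γ) (hβε : β ≠ ε) (hγδ : γ ≠ δ) (hδε : δ ≠ ε) (hαδ : G.layerGraph.Adj α δ)
    (hδβ : G.layerGraph.Adj δ β) (hαε : G.layerGraph.Adj α ε) (hεγ : G.layerGraph.Adj ε γ)
    {x₁ y₁ x₂ y₂ : V} (hx : x₁ ≠ x₂) : G.HasLayerCover (α, x₁) (β, y₁) (α, x₂) (γ, y₂) := by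
  obtain ⟨u, hu, hadju⟩ := exists_crossing hαδ {x₁, x₂} (by
    have := Finset.card_le_two (a := x₁) (b := x₂); omega)
  obtain ⟨v, hv, hadjv⟩ := exists_crossing hαε {x₁, x₂, u} (by
    have := Finset.card_le_three (a := x₁) (b := x₂) (c := u); omega)
  simp only [Finset.mem_insert, Finset.mem_singleton, not_or] at hu hv
  obtain ⟨l₁, l₂, hl₁, hl₂, hl⟩ := exists_layer_pair hL α hx (Ne.symm hv.2.2) (Ne.symm hu.1)
    (Ne.symm hv.1) (Ne.symm hu.2) (Ne.symm hv.2.1)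
  obtain ⟨m₁, hm₁, hm₁'⟩ := exists_link hL hV hδβ u y₁
  obtain ⟨m₂, hm₂, hm₂'⟩ := exists_link hL hV hεγ v y₂
  exact .of_layer_pair hl₁ hl₂ hl hadju hadjv hm₁ hm₁' hm₂ hm₂' (by simp [hαδ.ne, hαβ])
    (by simp [hαγ, hαε.ne]) (by simp [hδε.symm, hγδ, hβε.symm, hβγ.symm])

/-- The first path borrows the layer `γ`, in which the second path starts. This serves when `α` and
`β` are not adjacent and no further layer is adjacent to all four. -/
theorem hasLayerCover_of_one_each_through (hL : ∀ α, (G.layer α).IsPairedTwoDPC)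
    (hV : 4 ≤ Fintype.card V) (hV8 : 8 ≤ Fintype.card V) {α β γ δ : I} (hαβ : α ≠ β)
    (hαδ : α ≠ δ) (hβδ : β ≠ δ) (hαγ : G.layerGraph.Adj α γ) (hγβ : G.layerGraph.Adj γ β)
    (hγδ : G.layerGraph.Adj γ δ) {x₁ y₁ x₂ y₂ : V} :
    G.HasLayerCover (α, x₁) (β, y₁) (γ, x₂) (δ, y₂) := by
  obtain ⟨u, hu, hadju⟩ := exists_crossing hαγ {x₁, x₂} (by
    have := Finset.card_le_two (a := x₁) (b := x₂); omega)
  obtain ⟨w, hw, hadjw⟩ := exists_crossing hγβ {u, x₂, y₁} (by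
    have := Finset.card_le_three (a := u) (b := x₂) (c := y₁); omega)
  obtain ⟨v, hv, hadjv⟩ := exists_crossing hγδ {u, w, x₂, y₂} (by
    have := Finset.card_le_four (a := u) (b := w) (c := x₂) (d := y₂); omega)
  simp only [Finset.mem_insert, Finset.mem_singleton, not_or] at hu hw hv
  obtain ⟨k₁, k₂, hk₁, hk₂, hk⟩ := exists_layer_pair hL γ hu.2 (Ne.symm hv.2.1) (Ne.symm hw.1)
    (Ne.symm hv.1) (Ne.symm hw.2.1) (Ne.symm hv.2.2.1)
  obtain ⟨l, hl, hl'⟩ := exists_layer_path hL hV α (Ne.symm hu.1)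
  obtain ⟨m₁, hm₁, hm₁'⟩ := exists_layer_path hL hV β hw.2.2
  obtain ⟨m₂, hm₂, hm₂'⟩ := exists_layer_path hL hV δ hv.2.2.2
  refine ⟨_, _, _, ⟨α, by simp⟩, (hl.append hadju hk₁).append hadjw hm₁, hk₂.append hadjv hm₂,
    ((?_ : LayerCover ({α} ∪ {γ} ∪ {β}) _ _).append_snd hm₂' ?_)⟩
  · exact LayerCover.append_fst (by simpa using hl'.append hk (by simpa using hαγ.ne)) hm₁'
      (by simp [hαβ.symm, hγβ.ne.symm])
  · simp [hαδ.symm, hβδ.symm, hγδ.ne.symm]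

end SimpleGraph

/-! ### Finding connecting layers for every distribution of the terminals -/

namespace SimpleGraph

variable {I V : Type*} [Fintype I] [DecidableEq I]

/-- If the missing edges inside of `K` are numerous enough, then there are `j + 1` vertices outside
of `K` that are adjacent to all of `K`. -/
theorem exists_lt_card_adj_all (Q : SimpleGraph I) [DecidableRel Q.Adj] {B : ℕ}
    (hB : Qᶜ.edgeFinset.card ≤ B) (K : Finset I) (D : Finset (Sym2 I)) (j : ℕ)
    (hD : ∀ e ∈ D, e ∈ Qᶜ.edgeSet) (hDK : ∀ e ∈ D, ∀ x ∈ e, x ∈ K)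
    (h : B + K.card + j < Fintype.card I + D.card) :
    j < (Kᶜ.filter fun y => ∀ x ∈ K, Q.Adj y x).card := by
  have h1 := Q.card_le_card_adj_all K D (fun e he => mem_edgeFinset.2 (hD e he)) hDK
  have h2 := Finset.card_le_univ K
  rw [Finset.card_compl] at h1
  omega

theorem exists_adj_all (Q : SimpleGraph I) [DecidableRel Q.Adj] {B : ℕ}
    (hB : Qᶜ.edgeFinset.card ≤ B) (K : Finset I) (D : Finset (Sym2 I))
    (hD : ∀ e ∈ D, e ∈ Qᶜ.edgeSet) (hDK : ∀ e ∈ D, ∀ x ∈ e, x ∈ K)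
    (h : B + K.card < Fintype.card I + D.card) : ∃ y ∉ K, ∀ x ∈ K, Q.Adj y x := by
  obtain ⟨y, hy⟩ := Finset.card_pos.1 (Q.exists_lt_card_adj_all hB K D 0 hD hDK h)
  rw [Finset.mem_filter, Finset.mem_compl] at hy
  exact ⟨y, hy⟩

theorem exists_two_adj_all (Q : SimpleGraph I) [DecidableRel Q.Adj] {B : ℕ}
    (hB : Qᶜ.edgeFinset.card ≤ B) (K : Finset I) (D : Finset (Sym2 I))
    (hD : ∀ e ∈ D, e ∈ Qᶜ.edgeSet) (hDK : ∀ e ∈ D, ∀ x ∈ e, x ∈ K)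
    (h : B + K.card + 1 < Fintype.card I + D.card) :
    ∃ y z, y ≠ z ∧ y ∉ K ∧ z ∉ K ∧ (∀ x ∈ K, Q.Adj y x) ∧ ∀ x ∈ K, Q.Adj z x := by
  obtain ⟨y, hy, z, hz, hyz⟩ := Finset.one_lt_card.1 (Q.exists_lt_card_adj_all hB K D 1 hD hDK h)
  rw [Finset.mem_filter, Finset.mem_compl] at hy hz
  exact ⟨y, z, hyz, hy.1, hz.1, hy.2, hz.2⟩

variable [Fintype V] [DecidableEq V] {G : SimpleGraph (I × V)} [DecidableRel G.layerGraph.Adj]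

theorem hasLayerCover_of_first_pair_in_layer (hL : ∀ α, (G.layer α).IsPairedTwoDPC)
    (hV : 4 ≤ Fintype.card V) (hB : G.layerGraphᶜ.edgeFinset.card + 3 ≤ Fintype.card I)
    {α β γ : I} {x₁ y₁ x₂ y₂ : V} (h11 : x₁ ≠ y₁) (hs : (α, x₁) ≠ (β, x₂))
    (h12 : (α, x₁) ≠ (γ, y₂)) (h21 : (β, x₂) ≠ (α, y₁)) (ht : (α, y₁) ≠ (γ, y₂))
    (h22 : (β, x₂) ≠ (γ, y₂)) : G.HasLayerCover (α, x₁) (α, y₁) (β, x₂) (γ, y₂) := by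
  have hB' : G.layerGraphᶜ.edgeFinset.card ≤ Fintype.card I - 3 := by omega
  have hcommon : ∀ α β : I, α ≠ β →
      ∃ δ, G.layerGraph.Adj α δ ∧ G.layerGraph.Adj δ β := by
    intro α β hαβ
    obtain ⟨δ, -, h⟩ := exists_adj_all _ hB' {α, β} ∅ (by simp) (by simp) (by
      rw [Finset.card_pair hαβ]; omega)
    exact ⟨δ, (h α (by simp)).symm, h β (by simp)⟩
  have three : ∀ {α β : I} {x₁ y₁ x₂ y₂ : V}, α ≠ β → x₁ ≠ y₁ → x₁ ≠ x₂ → x₂ ≠ y₁ →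
      G.HasLayerCover (α, x₁) (α, y₁) (α, x₂) (β, y₂) := by
    intro α β x₁ y₁ x₂ y₂ hαβ h1 h2 h3
    obtain ⟨δ, h, h'⟩ := hcommon α β hαβ
    exact hasLayerCover_of_three_one hL hV h h' hαβ h1 h2 h3
  by_cases hβ : β = α
  · subst hβ
    have hs' : x₁ ≠ x₂ := fun h => hs (by rw [h])
    have h21' : x₂ ≠ y₁ := fun h => h21 (by rw [h])
    by_cases hγ : γ = β
    · subst hγ
      obtain ⟨l₁, l₂, hl₁, hl₂, hl⟩ := exists_layer_pair hL γ hs' (fun h => ht (by rw [h])) h11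
        (fun h => h12 (by rw [h])) h21' (fun h => h22 (by rw [h]))
      exact ⟨_, l₁, l₂, ⟨γ, by simp⟩, hl₁, hl₂, hl⟩
    · exact three (Ne.symm hγ) h11 hs' h21'
  · by_cases hγ : γ = α
    · subst hγ
      exact (three (Ne.symm hβ) h11 (fun h => h12 (by rw [h])) fun h => ht (by rw [h])).reverse_snd
    · obtain ⟨l, hl, hl'⟩ := exists_layer_path hL hV α h11
      by_cases hβγ : β = γ
      · subst hβγ
        obtain ⟨m, hm, hm'⟩ := exists_layer_path hL hV β (x := x₂) (y := y₂)
          fun h => h22 (by rw [h])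
        exact .of_disjoint ⟨α, by simp⟩ hl hl' hm hm' (by simpa using Ne.symm hβ)
      · by_cases hadj : G.layerGraph.Adj β γ
        · obtain ⟨m, hm, hm'⟩ := exists_link hL hV hadj x₂ y₂
          exact .of_disjoint ⟨α, by simp⟩ hl hl' hm hm' (by simp [Ne.symm hβ, Ne.symm hγ])
        -- The nonadjacency of `β` and `γ` itself uses up a missing pair, which makes the count
        -- succeed for a set of three layers.
        · obtain ⟨δ, hδ, h⟩ := exists_adj_all _ hB' {α, β, γ} {s(β, γ)}
            (by simp [hβγ, hadj]) (by simp) (by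
              rw [Finset.card_singleton]
              have := Finset.card_le_three (a := α) (b := β) (c := γ); omega)
          obtain ⟨m, hm, hm'⟩ := exists_link_via hL hV (h β (by simp)).symm (h γ (by simp)) hβγ
            x₂ y₂
          simp only [Finset.mem_insert, Finset.mem_singleton, not_or] at hδ
          exact .of_disjoint ⟨α, by simp⟩ hl hl' hm hm'
            (by simp [Ne.symm hβ, Ne.symm hγ, Ne.symm hδ.1])

/-- The alternatives in `hB8` compensate each other: one missing pair fewer gives one more
connecting layer, while larger layers allow the paths to share a layer or to cross directly. -/
theorem hasLayerCover_of_starts_in_layer (hL : ∀ α, (G.layer α).IsPairedTwoDPC)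
    (hV : 4 ≤ Fintype.card V) (hB : G.layerGraphᶜ.edgeFinset.card + 3 ≤ Fintype.card I)
    (hB8 : G.layerGraphᶜ.edgeFinset.card + 4 ≤ Fintype.card I ∨ 8 ≤ Fintype.card V)
    {α β γ : I} {x₁ y₁ x₂ y₂ : V} (hαβ : α ≠ β) (hαγ : α ≠ γ) (hs : x₁ ≠ x₂)
    (ht : (β, y₁) ≠ (γ, y₂)) : G.HasLayerCover (α, x₁) (β, y₁) (α, x₂) (γ, y₂) := by
  have hB' : G.layerGraphᶜ.edgeFinset.card ≤ Fintype.card I - 3 := by omega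
  by_cases hβγ : β = γ
  · subst hβγ
    have ht' : y₁ ≠ y₂ := fun h => ht (by rw [h])
    rcases hB8 with hB4 | hV8
    · obtain ⟨γ, δ, hγδ, -, -, h, h'⟩ := exists_two_adj_all G.layerGraph le_rfl {α, β} ∅ (by simp)
        (by simp) (by rw [Finset.card_pair hαβ]; omega)
      exact hasLayerCover_of_two_two_of_two_common hL hV hαβ hγδ (h α (by simp)).symm
        (h β (by simp)) (h' α (by simp)).symm (h' β (by simp)) hs ht'
    · obtain ⟨γ, -, h⟩ := exists_adj_all _ hB' {α, β} ∅ (by simp) (by simp) (by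
        rw [Finset.card_pair hαβ]; omega)
      exact hasLayerCover_of_two_two_of_common hL hV8 hαβ (h α (by simp)).symm (h β (by simp))
        hs ht'
  · have hK := Finset.card_le_three (a := α) (b := β) (c := γ)
    have one : ∀ {β γ : I} {x₁ x₂ y₁ y₂ : V}, β ≠ γ → α ≠ β → α ≠ γ → x₁ ≠ x₂ →
        G.layerGraph.Adj α β → ¬ G.layerGraph.Adj α γ →
        G.HasLayerCover (α, x₁) (β, y₁) (α, x₂) (γ, y₂) := by
      intro β γ x₁ x₂ y₁ y₂ hβγ hαβ hαγ hs h1 h2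
      have hK := Finset.card_le_three (a := α) (b := β) (c := γ)
      obtain ⟨δ, hδ, h⟩ := exists_adj_all _ hB' {α, β, γ} {s(α, γ)} (by simp [h2, hαγ]) (by simp)
        (by rw [Finset.card_singleton]; omega)
      simp only [Finset.mem_insert, Finset.mem_singleton, not_or] at hδ
      exact hasLayerCover_of_two_one_one_via hL hV hβγ h1 hαγ (Ne.symm hδ.2.1)
        (h α (by simp)).symm (h γ (by simp)) hs
    by_cases h1 : G.layerGraph.Adj α β
    · by_cases h2 : G.layerGraph.Adj α γ
      · rcases hB8 with hB4 | hV8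
        · obtain ⟨δ, hδ, h⟩ := exists_adj_all G.layerGraph le_rfl {α, β, γ} ∅ (by simp) (by simp)
            (by omega)
          simp only [Finset.mem_insert, Finset.mem_singleton, not_or] at hδ
          exact hasLayerCover_of_two_one_one_via hL hV hβγ h1 hαγ (Ne.symm hδ.2.1)
            (h α (by simp)).symm (h γ (by simp)) hs
        · exact hasLayerCover_of_two_one_one_direct hL hV hV8 hβγ h1 h2 hs
      · exact one hβγ hαβ hαγ hs h1 h2
    · by_cases h2 : G.layerGraph.Adj α γ
      · exact (one (Ne.symm hβγ) hαγ hαβ hs.symm h2 h1).swap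
      · obtain ⟨δ, ε, hδε, hδ, hε, h, h'⟩ := exists_two_adj_all _ hB' {α, β, γ} {s(α, β), s(α, γ)}
          (by simp [h1, h2, hαβ, hαγ]) (by simp) (by
            rw [Finset.card_pair (by simp [hβγ]; tauto)]; omega)
        simp only [Finset.mem_insert, Finset.mem_singleton, not_or] at hδ hε
        exact hasLayerCover_of_two_one_one_via_both hL hV hβγ hαβ hαγ (Ne.symm hε.2.1)
          (Ne.symm hδ.2.2) hδε (h α (by simp)).symm (h β (by simp)) (h' α (by simp)).symm
          (h' γ (by simp)) hs

theorem hasLayerCover_of_one_each (hL : ∀ α, (G.layer α).IsPairedTwoDPC)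
    (hV : 4 ≤ Fintype.card V) (hB : G.layerGraphᶜ.edgeFinset.card + 3 ≤ Fintype.card I)
    (hB8 : G.layerGraphᶜ.edgeFinset.card + 4 ≤ Fintype.card I ∨ 8 ≤ Fintype.card V)
    (hB6 : G.layerGraphᶜ.edgeFinset.card ≤ 1 ∨ 6 ≤ Fintype.card I)
    {α β γ δ : I} {x₁ y₁ x₂ y₂ : V} (hαβ : α ≠ β) (hαγ : α ≠ γ) (hαδ : α ≠ δ) (hβγ : β ≠ γ)
    (hβδ : β ≠ δ) (hγδ : γ ≠ δ) : G.HasLayerCover (α, x₁) (β, y₁) (γ, x₂) (δ, y₂) := by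
  have hB' : G.layerGraphᶜ.edgeFinset.card ≤ Fintype.card I - 3 := by omega
  have one : ∀ {α β γ δ : I} {x₁ y₁ x₂ y₂ : V}, α ≠ β → α ≠ γ → α ≠ δ → β ≠ γ → β ≠ δ → γ ≠ δ →
      ¬ G.layerGraph.Adj α β → G.layerGraph.Adj γ δ →
      G.HasLayerCover (α, x₁) (β, y₁) (γ, x₂) (δ, y₂) := by
    intro α β γ δ x₁ y₁ x₂ y₂ hαβ hαγ hαδ hβγ hβδ hγδ h1 h2
    have hK := Finset.card_le_four (a := α) (b := β) (c := γ) (d := δ)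
    by_cases hε : ∃ ε ∉ ({α, β, γ, δ} : Finset I),
        ∀ x ∈ ({α, β, γ, δ} : Finset I), G.layerGraph.Adj ε x
    · obtain ⟨ε, hε, h⟩ := hε
      simp only [Finset.mem_insert, Finset.mem_singleton, not_or] at hε
      obtain ⟨l, hl, hl'⟩ := exists_link_via hL hV (h α (by simp)).symm (h β (by simp)) hαβ x₁ y₁
      obtain ⟨m, hm, hm'⟩ := exists_link hL hV h2 x₂ y₂
      exact .of_disjoint ⟨α, by simp⟩ hl hl' hm hm' (by
        simp [hαγ.symm, hαδ.symm, hβγ.symm, hβδ.symm, Ne.symm hε.2.2.1, Ne.symm hε.2.2.2])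
    · rcases hB8 with hB4 | hV8
      · exact absurd (exists_adj_all G.layerGraph le_rfl {α, β, γ, δ} {s(α, β)} (by simp [h1, hαβ])
          (by simp) (by rw [Finset.card_singleton]; omega)) hε
      -- A second missing pair inside the four layers would free a layer adjacent to all of them,
      -- contrary to `hε`.
      · have hadj : ∀ x, (x = α ∨ x = β) → x ≠ γ → G.layerGraph.Adj γ x := by
          intro x hx hxγ
          by_contra hc
          refine hε (exists_adj_all _ hB' {α, β, γ, δ} {s(α, β), s(γ, x)}
            (by simp [h1, hαβ, hc, Ne.symm hxγ]) (by simp; tauto) ?_)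
          rw [Finset.card_pair (by simp [hαγ, hβγ])]
          omega
        exact hasLayerCover_of_one_each_through hL hV hV8 hαβ hαδ hβδ
          (hadj α (by simp) hαγ).symm (hadj β (by simp) hβγ) h2
  by_cases h1 : G.layerGraph.Adj α β
  · by_cases h2 : G.layerGraph.Adj γ δ
    · obtain ⟨l, hl, hl'⟩ := exists_link hL hV h1 x₁ y₁
      obtain ⟨m, hm, hm'⟩ := exists_link hL hV h2 x₂ y₂
      exact .of_disjoint ⟨α, by simp⟩ hl hl' hm hm' (by
        simp [hαγ.symm, hαδ.symm, hβγ.symm, hβδ.symm])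
    · exact (one hγδ hαγ.symm hβγ.symm hαδ.symm hβδ.symm hαβ h2 h1).swap
  · by_cases h2 : G.layerGraph.Adj γ δ
    · exact one hαβ hαγ hαδ hβγ hβδ hγδ h1 h2
    · have hD2 : ({s(α, β), s(γ, δ)} : Finset (Sym2 I)).card = 2 :=
        Finset.card_pair (by simp [hαγ, hαδ])
      have hn : 6 ≤ Fintype.card I := by
        refine hB6.resolve_left fun h => ?_
        have : ({s(α, β), s(γ, δ)} : Finset (Sym2 I)) ⊆ G.layerGraphᶜ.edgeFinset := by
          intro e he
          rw [mem_edgeFinset]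
          simp only [Finset.mem_insert, Finset.mem_singleton] at he
          rcases he with rfl | rfl <;> simp [*]
        have := Finset.card_le_card this
        omega
      have finish : ∀ φ ψ : I, φ ≠ ψ → φ ∉ ({α, β, γ, δ} : Finset I) →
          ψ ∉ ({α, β, γ, δ} : Finset I) → G.layerGraph.Adj φ α → G.layerGraph.Adj φ β →
          G.layerGraph.Adj ψ γ → G.layerGraph.Adj ψ δ →
          G.HasLayerCover (α, x₁) (β, y₁) (γ, x₂) (δ, y₂) := by
        intro φ ψ hφψ hφ hψ hφα hφβ hψγ hψδ
        simp only [Finset.mem_insert, Finset.mem_singleton, not_or] at hφ hψ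
        obtain ⟨l, hl, hl'⟩ := exists_link_via hL hV hφα.symm hφβ hαβ x₁ y₁
        obtain ⟨m, hm, hm'⟩ := exists_link_via hL hV hψγ.symm hψδ hγδ x₂ y₂
        refine .of_disjoint ⟨α, by simp⟩ hl hl' hm hm' ?_
        rw [Finset.disjoint_left]
        intro a ha hb
        simp only [Finset.mem_insert, Finset.mem_singleton, Finset.mem_union] at ha hb
        grind
      have hK := Finset.card_le_four (a := α) (b := β) (c := γ) (d := δ)
      obtain ⟨φ, hφ, h⟩ := exists_adj_all _ hB' {α, β, γ, δ} {s(α, β), s(γ, δ)}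
        (by simp [h1, h2, hαβ, hγδ]) (by simp) (by rw [hD2]; omega)
      obtain ⟨ψ, hψ⟩ : ((insert φ ({α, β, γ, δ} : Finset I))ᶜ).Nonempty := by
        rw [← Finset.card_pos, Finset.card_compl]
        have := Finset.card_insert_le φ ({α, β, γ, δ} : Finset I)
        omega
      rw [Finset.mem_compl, Finset.mem_insert, not_or] at hψ
      by_cases hψ1 : G.layerGraph.Adj ψ α ∧ G.layerGraph.Adj ψ β
      · exact finish ψ φ hψ.1 hψ.2 hφ hψ1.1 hψ1.2 (h γ (by simp)) (h δ (by simp))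
      · by_cases hψ2 : G.layerGraph.Adj ψ γ ∧ G.layerGraph.Adj ψ δ
        · exact finish φ ψ (Ne.symm hψ.1) hφ hψ.2 (h α (by simp)) (h β (by simp)) hψ2.1 hψ2.2
        -- Now `ψ` fails on both sides, which puts four missing pairs inside a set of five layers;
        -- hence two layers outside are adjacent to all five.
        · obtain ⟨x, hx, hx'⟩ : ∃ x, (x = α ∨ x = β) ∧ ¬ G.layerGraph.Adj ψ x := by
            by_contra! hc
            exact hψ1 ⟨hc α (by simp), hc β (by simp)⟩
          obtain ⟨y, hy, hy'⟩ : ∃ y, (y = γ ∨ y = δ) ∧ ¬ G.layerGraph.Adj ψ y := by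
            by_contra! hc
            exact hψ2 ⟨hc γ (by simp), hc δ (by simp)⟩
          have hψ' := hψ.2
          simp only [Finset.mem_insert, Finset.mem_singleton, not_or] at hψ'
          have hxψ : ψ ≠ x := by grind
          have hyψ : ψ ≠ y := by grind
          have hxy : x ≠ y := by grind
          have hxK : x ∈ insert ψ ({α, β, γ, δ} : Finset I) := by rcases hx with rfl | rfl <;> simp
          have hyK : y ∈ insert ψ ({α, β, γ, δ} : Finset I) := by rcases hy with rfl | rfl <;> simp
          have hD4 : ({s(ψ, x), s(ψ, y), s(α, β), s(γ, δ)} : Finset (Sym2 I)).card = 4 := by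
            rw [Finset.card_insert_of_notMem, Finset.card_insert_of_notMem, hD2]
            · simp [hψ']
            · simp [hψ', hxy, hyψ]
          obtain ⟨φ, φ', hφφ', hφ, hφ', h, h'⟩ := exists_two_adj_all _ hB'
            (insert ψ {α, β, γ, δ}) {s(ψ, x), s(ψ, y), s(α, β), s(γ, δ)}
            (by simp [h1, h2, hαβ, hγδ, hxψ, hyψ, hx', hy']) (by
              intro e he z hz
              simp only [Finset.mem_insert, Finset.mem_singleton] at he
              rcases he with rfl | rfl | rfl | rfl <;> rw [Sym2.mem_iff] at hz <;>
                rcases hz with h | h <;> rw [h] <;> first | exact hxK | exact hyK | simp) (by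
              have := Finset.card_insert_le ψ ({α, β, γ, δ} : Finset I)
              rw [hD4]; omega)
          exact finish φ φ' hφφ' (fun h => hφ (Finset.mem_insert_of_mem h))
            (fun h => hφ' (Finset.mem_insert_of_mem h)) (h α (by simp)) (h β (by simp))
            (h' γ (by simp)) (h' δ (by simp))

/-- A graph on `I × V` is paired 2-disjoint path coverable if all its layers are and few pairs of
layers have many edges missing between them. -/
theorem isPairedTwoDPC_of_layers (hL : ∀ α, (G.layer α).IsPairedTwoDPC)
    (hV : 4 ≤ Fintype.card V) (hB : G.layerGraphᶜ.edgeFinset.card + 3 ≤ Fintype.card I)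
    (hB8 : G.layerGraphᶜ.edgeFinset.card + 4 ≤ Fintype.card I ∨ 8 ≤ Fintype.card V)
    (hB6 : G.layerGraphᶜ.edgeFinset.card ≤ 1 ∨ 6 ≤ Fintype.card I) : G.IsPairedTwoDPC := by
  refine isPairedTwoDPC_of_exists_lists fun s₁ t₁ s₂ t₂ hs ht h11 h12 h21 h22 => ?_
  suffices h : G.HasLayerCover s₁ t₁ s₂ t₂ by
    obtain ⟨C, l₁, l₂, hC, hl₁, hl₂, hc, hrich⟩ := h
    obtain ⟨σ, hσ, hcyc⟩ := G.layerGraph.exists_cyclic_successor_univ hB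
    exact exists_cover_of_cyclic_successor hL hV hσ hcyc _ C l₁ l₂ rfl hC hl₁ hl₂ hc
      fun γ hγ _ => hrich γ hγ
  obtain ⟨α, x₁⟩ := s₁
  obtain ⟨β, y₁⟩ := t₁
  obtain ⟨γ, x₂⟩ := s₂
  obtain ⟨δ, y₂⟩ := t₂
  by_cases hαβ : α = β
  · subst hαβ
    exact hasLayerCover_of_first_pair_in_layer hL hV hB (fun h => h11 (by rw [h])) hs h12 h21 ht h22
  by_cases hγδ : γ = δ
  · subst hγδ
    exact (hasLayerCover_of_first_pair_in_layer hL hV hB (fun h => h22 (by rw [h])) hs.symm h21 h12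
      ht.symm h11).swap
  have crossed : ∀ {α β γ δ : I} {x₁ y₁ x₂ y₂ : V}, α = γ → α ≠ β → γ ≠ δ → (α, x₁) ≠ (γ, x₂) →
      (β, y₁) ≠ (δ, y₂) → G.HasLayerCover (α, x₁) (β, y₁) (γ, x₂) (δ, y₂) := by
    rintro α β _ δ x₁ y₁ x₂ y₂ rfl hαβ hαδ hs ht
    exact hasLayerCover_of_starts_in_layer hL hV hB hB8 hαβ hαδ (fun h => hs (by rw [h])) ht
  by_cases hαγ : α = γ
  · exact crossed hαγ hαβ hγδ hs ht
  by_cases hβδ : β = δ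
  · exact (crossed hβδ (Ne.symm hαβ) (Ne.symm hγδ) ht hs).reverse_fst.reverse_snd
  by_cases hαδ : α = δ
  · exact (crossed hαδ hαβ (Ne.symm hγδ) h12 h21.symm).reverse_snd
  by_cases hβγ : β = γ
  · exact (crossed hβγ (Ne.symm hαβ) hγδ h21.symm h12).reverse_fst
  exact hasLayerCover_of_one_each hL hV hB hB8 hB6 hαβ hαγ hαδ hβγ hβδ hγδ

end SimpleGraph

/-! ### Splitting BCube along a dimension and counting faults -/

namespace BCube

theorem adj_insertNth {n k : ℕ} (j : Fin (k + 2)) (α : Fin n) {u v : BCubeNode n k} {i : Fin (k + 1)}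
    (h : (BCube n k).Adj u v) (hi : u i ≠ v i) :
    (BCube n (k + 1)).Adj (j.insertNth α u : BCubeNode n (k + 1)) (j.insertNth α v) ∧
      (j.insertNth α u : BCubeNode n (k + 1)) (j.succAbove i) ≠
        (j.insertNth α v : BCubeNode n (k + 1)) (j.succAbove i) := by
  refine ⟨⟨j.succAbove i, by simpa using hi, fun l hl => ?_⟩, by simpa using hi⟩
  rcases eq_or_ne l j with rfl | hlj
  · simp at hl
  · obtain ⟨m, rfl⟩ := Fin.exists_succAbove_eq hlj
    rw [h.unique (y₁ := m) (y₂ := i) (by simpa using hl) hi]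

theorem adj_insertNth_cross {n k : ℕ} (j : Fin (k + 2)) {α β : Fin n} (hαβ : α ≠ β)
    (v : BCubeNode n k) :
    (BCube n (k + 1)).Adj (j.insertNth α v : BCubeNode n (k + 1)) (j.insertNth β v) := by
  refine ⟨j, by simpa using hαβ, fun l hl => ?_⟩
  by_contra hlj
  obtain ⟨m, rfl⟩ := Fin.exists_succAbove_eq hlj
  simp at hl

theorem mk_mem_dimEdges {n k : ℕ} {i : Fin (k + 1)} {u v : BCubeNode n k} (h : (BCube n k).Adj u v)
    (hi : u i ≠ v i) : s(u, v) ∈ dimEdges n k i := ⟨u, v, h, hi, rfl⟩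

/-- The edges of a set that lie in the subcube with entry `α` in position `j`. -/
def layerEdges {n k : ℕ} (F : Set (Sym2 (BCubeNode n (k + 1)))) (j : Fin (k + 2)) (α : Fin n) :
    Set (Sym2 (BCubeNode n k)) :=
  {e | e.map (fun v => (j.insertNth α v : BCubeNode n (k + 1))) ∈ F}

theorem faultCount_layerEdges_le {n k : ℕ} (F : Set (Sym2 (BCubeNode n (k + 1)))) (j : Fin (k + 2))
    (α : Fin n) (i : Fin (k + 1)) :
    faultCount (layerEdges F j α) i ≤ faultCount F (j.succAbove i) := by
  refine Set.ncard_le_ncard_of_injOn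
    (Sym2.map fun v => (j.insertNth α v : BCubeNode n (k + 1))) ?_ ?_ (Set.toFinite _)
  · rintro _ ⟨hF, u, v, hadj, hi, rfl⟩
    have := adj_insertNth j α hadj hi
    exact ⟨hF, mk_mem_dimEdges this.1 this.2⟩
  · exact (Sym2.map.injective (Fin.insertNth_right_injective (α := fun _ => Fin n) α)).injOn

/-- The graph `BC_{n,k+1} - F` with the nodes written as pairs of the entry in position `j` and the
remaining word. -/
def splitGraph {n k : ℕ} (F : Set (Sym2 (BCubeNode n (k + 1)))) (j : Fin (k + 2)) :
    SimpleGraph (Fin n × BCubeNode n k) :=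
  ((BCube n (k + 1)).deleteEdges F).comap (Fin.insertNthEquiv (fun _ => Fin n) j)

theorem splitGraph_adj {n k : ℕ} {F : Set (Sym2 (BCubeNode n (k + 1)))} {j : Fin (k + 2)}
    {p q : Fin n × BCubeNode n k} : (splitGraph F j).Adj p q ↔
      (BCube n (k + 1)).Adj (j.insertNth p.1 p.2 : BCubeNode n (k + 1)) (j.insertNth q.1 q.2) ∧
        s((j.insertNth p.1 p.2 : BCubeNode n (k + 1)), j.insertNth q.1 q.2) ∉ F := by
  simp [splitGraph, SimpleGraph.deleteEdges_adj, Fin.insertNthEquiv]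

theorem deleteEdges_le_layer {n k : ℕ} (F : Set (Sym2 (BCubeNode n (k + 1)))) (j : Fin (k + 2))
    (α : Fin n) :
    (BCube n k).deleteEdges (layerEdges F j α) ≤ (splitGraph F j).layer α := by
  intro u v h
  rw [SimpleGraph.deleteEdges_adj] at h
  obtain ⟨i, hi, -⟩ := id h.1
  exact splitGraph_adj.2 ⟨(adj_insertNth j α h.1 hi).1, h.2⟩

/-- With `N = n ^ (k + 1)` and `c` faulty crossings, nonadjacency means `2 c + 4 > N`, that is `c ≥
⌊N/2⌋ - 1`. Distinct pairs of layers have disjoint sets of crossings. -/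
theorem card_layerGraph_compl_mul_le {n k : ℕ} (F : Set (Sym2 (BCubeNode n (k + 1))))
    (j : Fin (k + 2)) [DecidableRel (splitGraph F j).layerGraph.Adj] :
    (splitGraph F j).layerGraphᶜ.edgeFinset.card * (n ^ (k + 1) / 2 - 1) ≤ faultCount F j := by
  classical
  set S := (F ∩ dimEdges n (k + 1) j).toFinite.toFinset with hS
  have hcard : faultCount F j = S.card := Set.ncard_eq_toFinset_card _ _
  rw [hcard]
  set g : Sym2 (BCubeNode n (k + 1)) → Sym2 (Fin n) := Sym2.map fun v => v j with hg
  have h1 : ∀ b ∈ (splitGraph F j).layerGraphᶜ.edgeFinset,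
      n ^ (k + 1) / 2 - 1 ≤ (S.filter fun e => g e = b).card := by
    intro b hb
    rw [SimpleGraph.mem_edgeFinset] at hb
    induction b using Sym2.ind with
    | _ α β =>
    rw [SimpleGraph.mem_edgeSet, SimpleGraph.compl_adj] at hb
    obtain ⟨hαβ, hb⟩ := hb
    have hw : ¬ (2 * ((splitGraph F j).crossFaults α β).card + 4 ≤
        Fintype.card (BCubeNode n k)) := fun h => hb ⟨hαβ, h⟩
    have hV : Fintype.card (BCubeNode n k) = n ^ (k + 1) := by simp
    rw [hV] at hw
    refine le_trans (by omega : _ ≤ ((splitGraph F j).crossFaults α β).card) ?_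
    refine Finset.card_le_card_of_injOn
      (fun v => s((j.insertNth α v : BCubeNode n (k + 1)), j.insertNth β v)) ?_ ?_
    · intro v hv
      have hv' := SimpleGraph.mem_crossFaults.1 hv
      rw [splitGraph_adj] at hv'
      have hadj := adj_insertNth_cross j hαβ v
      have hF : s((j.insertNth α v : BCubeNode n (k + 1)), j.insertNth β v) ∈ F := by
        by_contra h
        exact hv' ⟨hadj, h⟩
      simp only [Finset.coe_filter, Set.mem_ofPred_eq, hS, Set.Finite.mem_toFinset]
      exact ⟨⟨hF, mk_mem_dimEdges hadj (by simpa using hαβ)⟩, by simp [hg]⟩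
    · intro v _ w _ hvw
      simp only [Sym2.eq_iff] at hvw
      rcases hvw with h | h
      · exact Fin.insertNth_right_injective (α := fun _ => Fin n) α h.1
      · have := congrFun h.1 j
        simp only [Fin.insertNth_apply_same] at this
        exact absurd this hαβ
  have h2 := Finset.card_nsmul_le_sum _ _ _ h1
  rw [smul_eq_mul] at h2
  refine h2.trans ?_
  rw [← Finset.card_biUnion]
  · exact Finset.card_le_card (Finset.biUnion_subset.2 fun b _ => Finset.filter_subset _ _)
  · intro b _ c _ hbc
    rw [Function.onFun, Finset.disjoint_left]
    intro e he he'
    exact hbc ((Finset.mem_filter.1 he).2.symm.trans (Finset.mem_filter.1 he').2)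

theorem ceil_half_sub_one (N : ℕ) (hN : 1 ≤ N) : ⌈((N : ℚ) - 1) / 2⌉ = ((N / 2 : ℕ) : ℤ) := by
  rw [Int.ceil_eq_iff]
  rcases Nat.even_or_odd' N with ⟨m, rfl | rfl⟩
  · rw [Nat.mul_div_cancel_left _ (by norm_num)]
    push_cast
    constructor <;> linarith
  · rw [show (2 * m + 1) / 2 = m by omega]
    push_cast
    constructor <;> linarith

/-- The fault bounds limit the number of pairs of subcubes with many faulty edges in between. -/
theorem bad_pairs_bounds {n k f B : ℕ} (hn : 4 ≤ n) (hf : (f : ℚ) ≤ faultBound n (k + 1))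
    (hB : B * (n ^ (k + 1) / 2 - 1) ≤ f) :
    B + 3 ≤ n ∧ (B + 4 ≤ n ∨ 8 ≤ n ^ (k + 1)) ∧ (B ≤ 1 ∨ 6 ≤ n) := by
  set N := n ^ (k + 1) with hN
  have hnN : n ≤ N := Nat.le_self_pow (by omega) n
  rw [faultBound, if_neg (by omega)] at hf
  by_cases h9 : n ≤ 9
  · rw [if_pos h9] at hf
    -- The truncated subtraction matches the maximum with 0 in the bound; it matters for `N = 4`.
    have hf' : f ≤ N - 5 := by
      rcases le_max_iff.1 hf with h | h
      · have : f = 0 := by exact_mod_cast le_antisymm h (by positivity)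
        omega
      · have : ((f + 5 : ℕ) : ℚ) ≤ (N : ℕ) := by push_cast [hN]; linarith
        have : f + 5 ≤ N := by exact_mod_cast this
        omega
    -- Two bad pairs would need `2 (⌊N/2⌋ - 1) ≥ N - 3` faults.
    have hB1 : B ≤ 1 := by
      by_contra! h
      have := Nat.mul_le_mul_right (N / 2 - 1) h
      omega
    have hB0 : N < 6 → B = 0 := by
      intro h
      by_contra hB0
      have := Nat.mul_le_mul_right (N / 2 - 1) (Nat.one_le_iff_ne_zero.2 hB0)
      omega
    -- For `n = 4` a single bad pair would violate both `B + 3 ≤ n - 1` and, if `N = 4`, its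
    -- alternative; but `N = 4` admits no faults.
    have hN4 : n = 4 → 8 ≤ N ∨ B = 0 := by
      intro h4
      rcases Nat.eq_zero_or_pos k with rfl | hk
      · right; apply hB0; simp [hN, h4]
      · left
        rw [hN, h4]
        calc 8 ≤ 4 ^ 2 := by norm_num
          _ ≤ 4 ^ (k + 1) := Nat.pow_le_pow_right (by norm_num) (by omega)
    omega
  · rw [if_neg h9] at hf
    have hBn : B + 3 ≤ n := by
      by_contra! h
      -- With `B ≥ n - 2`, comparison with the bound `⌊N/2⌋ (n - 2) - 3 n / 2` would give `3 n / 2 ≤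
      -- n - 2`.
      have h1 := (Nat.mul_le_mul_right (N / 2 - 1) (show n - 2 ≤ B by omega)).trans hB
      have h2 : (((n - 2) * (N / 2 - 1) : ℕ) : ℚ) ≤ f := by exact_mod_cast h1
      have hc : (⌈((n : ℚ) ^ (k + 1) - 1) / 2⌉ : ℚ) = ((N / 2 : ℕ) : ℚ) := by
        have := ceil_half_sub_one N (by omega)
        rw [hN, Nat.cast_pow] at this
        rw [this, Int.cast_natCast, hN]
      rw [hc] at hf
      have h3 : 1 ≤ N / 2 := by omega
      rw [Nat.cast_mul, Nat.cast_sub (by omega), Nat.cast_sub h3] at h2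
      have h4 : (10 : ℚ) ≤ n := by exact_mod_cast (by omega : 10 ≤ n)
      push_cast at h2 hf
      nlinarith
    exact ⟨hBn, Or.inr (by omega), Or.inr (by omega)⟩

theorem isPairedTwoDPC_of_faultCount_zero {n : ℕ} {F : Set (Sym2 (BCubeNode n 0))}
    (hF : (faultCount F 0 : ℚ) ≤ faultBound n 0) :
    ((BCube n 0).deleteEdges F).IsPairedTwoDPC := by
  have hle : ((BCube n 0).deleteEdges F)ᶜ.edgeSet.ncard ≤ faultCount F 0 := by
    refine Set.ncard_le_ncard ?_ (Set.toFinite _)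
    intro e he
    induction e using Sym2.ind with
    | _ u v =>
    rw [SimpleGraph.mem_edgeSet, SimpleGraph.compl_adj, SimpleGraph.deleteEdges_adj] at he
    have h0 : u 0 ≠ v 0 := fun h => he.1 (funext fun i => by rw [Fin.fin_one_eq_zero i]; exact h)
    have hadj : (BCube n 0).Adj u v := ⟨0, h0, fun i _ => Fin.fin_one_eq_zero i⟩
    refine ⟨?_, mk_mem_dimEdges hadj h0⟩
    by_contra h
    exact he.2 ⟨hadj, h⟩
  have hV : Fintype.card (BCubeNode n 0) = n := by simp
  rw [faultBound, if_pos rfl] at hF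
  apply SimpleGraph.isPairedTwoDPC_of_card_compl_le <;> rw [hV]
  · have : faultCount F 0 + 4 ≤ n := by
      split_ifs at hF with h
      · have : ((faultCount F 0 + 5 : ℕ) : ℚ) ≤ n := by push_cast; linarith
        have : faultCount F 0 + 5 ≤ n := by exact_mod_cast this
        omega
      · have : ((faultCount F 0 + 4 : ℕ) : ℚ) ≤ n := by push_cast; linarith
        exact_mod_cast this
    omega
  · intro h7
    rw [if_pos h7] at hF
    have : ((faultCount F 0 + 5 : ℕ) : ℚ) ≤ n := by push_cast; linarith
    have : faultCount F 0 + 5 ≤ n := by exact_mod_cast this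
    omega

/-- The sorted order of the fault counts need not persist in a layer. An arbitrary injective
assignment `π` of dimensions to bounds does persist, so the induction runs over it. -/
theorem isPairedTwoDPC_of_faultCount_le {n : ℕ} (hn : 4 ≤ n) (k : ℕ) :
    ∀ (F : Set (Sym2 (BCubeNode n k))) (π : Fin (k + 1) → Fin (k + 1)), Function.Injective π →
      (∀ i, (faultCount F (π i) : ℚ) ≤ faultBound n i) →
      ((BCube n k).deleteEdges F).IsPairedTwoDPC := by
  induction k with
  | zero =>
    intro F π _ hF
    have := hF 0
    rw [Fin.fin_one_eq_zero (π 0)] at this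
    exact isPairedTwoDPC_of_faultCount_zero (by simpa using this)
  | succ k ih =>
    intro F π hπ hF
    classical
    -- The split is along the dimension with the last bound; the other dimensions, renumbered by
    -- `ρ`, keep theirs.
    set j := π (Fin.last (k + 1)) with hj
    have hex : ∀ i : Fin (k + 1), ∃ i', j.succAbove i' = π i.castSucc := fun i =>
      Fin.exists_succAbove_eq fun h => (Fin.castSucc_lt_last i).ne (hπ h)
    choose ρ hρ using hex
    have hρinj : Function.Injective ρ := fun a b hab =>
      Fin.castSucc_injective _ (hπ (by rw [← hρ, ← hρ, hab]))
    have hV : Fintype.card (BCubeNode n k) = n ^ (k + 1) := by simp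
    have hlast := hF (Fin.last (k + 1))
    rw [Fin.val_last] at hlast
    obtain ⟨hB, hB8, hB6⟩ := bad_pairs_bounds hn hlast (card_layerGraph_compl_mul_le F j)
    refine SimpleGraph.IsPairedTwoDPC.of_comap_equiv (Fin.insertNthEquiv (fun _ => Fin n) j) ?_
    refine SimpleGraph.isPairedTwoDPC_of_layers (G := splitGraph F j) (fun α => ?_) ?_ ?_ ?_ ?_
    · refine (ih (layerEdges F j α) ρ hρinj fun i => ?_).mono (deleteEdges_le_layer F j α)
      refine le_trans ?_ (hF i.castSucc)
      rw [← hρ]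
      exact_mod_cast faultCount_layerEdges_le F j α (ρ i)
    · rw [hV]
      exact hn.trans (Nat.le_self_pow (by omega) n)
    · simpa using hB
    · simpa using hB8
    · simpa using hB6

end BCube

theorem theorem1 (n k : ℕ) (hn : 4 ≤ n) (F : Set (Sym2 (BCubeNode n k)))
    (hF : BCube.IsFPEF F) :
    ((BCube n k).deleteEdges F).IsPairedTwoDPC := by
  exact BCube.isPairedTwoDPC_of_faultCount_le hn k F _ (Equiv.injective _) hF.2
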